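/- Let $(\mathcal A,\tau)$ be a $C^*$-probability space, that is, $\mathcal A$ is a unital $C^*$-algebra and $\tau:\mathcal A\to\mathbb C$ is a positive unital linear functional. A partition of $[m]=\{1,\dots,m\}$ is non-crossing if $p<q<r<s$, $p,r\in V$, $q,s\in W$ for two of its blocks $V,W$ imply $V=W$; let $NC(m)$ be the set of non-crossing partitions of $[m]$, ordered by $\pi\preceq\sigma$ if every block of $\pi$ is contained in a block of $\sigma$. For $\pi\in NC(m)$, the Kreweras complement $Kr(\pi)$ is the largest $\sigma\in NC(m)$ such that the partition of $[2m]$ obtained by drawing $\pi$ on the odd points $1,3,\dots,2m-1$ and $\sigma$ on the even points $2,4,\dots,2m$ is non-crossing. The free cumulants $\kappa_m:\mathcal A^m\to\mathbb C$, $m\ge 1$, are defined recursively by $$\tau(x_1\cdots x_m)=\sum_{\pi\in NC(m)}\kappa_\pi(x_1,\dots,x_m),\qquad \kappa_\pi(x_1,\dots,x_m):=\prod_{V=\{v_1<\dots<v_s\}\in\pi}\kappa_{s}(x_{v_1},\dots,x_{v_s}),$$ and $\kappa_m(x):=\kappa_m(x,\dots,x)$. Elements $a_1,\dots,a_k\in\mathcal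 A$ are called free if $\kappa_m(a_{i_1},\dots,a_{i_m})=0$ for all $m\ge1$ and $1\le i_1,\dots,i_m\le k$, unless $i_1=\dots=i_m$. Theorem. Let $k,n\ge 1$, let $a_1,\dots,a_k\in\mathcal A$ be free and let $a:=a_1a_2\cdots a_k$. Then $$\kappa_n(a)=\sum_{\pi\in NC_k(n)}\kappa_{Kr(\pi)}(a_1,\dots,a_k,\,a_1,\dots,a_k,\,\dots,\,a_1,\dots,a_k),$$ $$\tau(a^n)=\sum_{\pi\in NC^k(n)}\kappa_{Kr(\pi)}(a_1,\dots,a_k,\,a_1,\dots,a_k,\,\dots,\,a_1,\dots,a_k),$$ where the list $a_1,\dots,a_k$ is repeated $n$ times in the arguments, $NC_k(n)$ is the set of partitions in $NC(kn)$ all of whose blocks have exactly $k$ elements, and $NC^k(n)$ is the set of partitions in $NC(kn)$ all of whose block sizes are multiples of $k$. -/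

import Mathlib

namespace FreeProb

section Partitions

/-- A partition of a finite, totally ordered set is non-crossing if `a < b < c < d`, `a, c ∈ V` and
`b, d ∈ W` for two blocks `V`, `W` force `V = W`. -/
def IsNonCrossing {α : Type*} [Fintype α] [LinearOrder α]
    (π : Finpartition (Finset.univ : Finset α)) : Prop :=
  ∀ a b c d : α, a < b → b < c → c < d → ∀ V ∈ π.parts, ∀ W ∈ π.parts,
    a ∈ V → c ∈ V → b ∈ W → d ∈ W → V = W

instance {α : Type*} [Fintype α] [LinearOrder α] :
    DecidablePred (IsNonCrossing (α := α)) := fun π => by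
  unfold IsNonCrossing; infer_instance

/-- The non-crossing partitions of `{0, …, n - 1}`. The order inherited from `Finpartition` is the
order of reverse refinement: `π ≤ σ` iff every block of `π` is contained in a block of `σ`. -/
abbrev NC (n : ℕ) : Type :=
  {π : Finpartition (Finset.univ : Finset (Fin n)) // IsNonCrossing π}

/-- The position of `i` among the odd places (counted from one) of a word of length `2 n`. -/
def oddPos {n : ℕ} : Fin n ↪ Fin (2 * n) where
  toFun i := ⟨2 * i.1, by omega⟩
  inj' i j h := by
    have := congrArg Fin.val h
    ext
    simp only at this
    omega

/-- The position of `i` among the even places (counted from one) of a word of length `2 n`. -/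
def evenPos {n : ℕ} : Fin n ↪ Fin (2 * n) where
  toFun i := ⟨2 * i.1 + 1, by omega⟩
  inj' i j h := by
    have := congrArg Fin.val h
    ext
    simp only at this
    omega

theorem oddPos_val {n : ℕ} (i : Fin n) : (oddPos i).1 = 2 * i.1 := rfl

theorem evenPos_val {n : ℕ} (i : Fin n) : (evenPos i).1 = 2 * i.1 + 1 := rfl

theorem oddPos_ne_evenPos {n : ℕ} (i j : Fin n) : oddPos i ≠ evenPos j := by
  intro h
  have := congrArg Fin.val h
  rw [oddPos_val, evenPos_val] at this
  omega

theorem exists_pos {n : ℕ} (x : Fin (2 * n)) :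
    (∃ i : Fin n, oddPos i = x) ∨ (∃ i : Fin n, evenPos i = x) := by
  rcases Nat.even_or_odd' x.1 with ⟨m, hm | hm⟩
  · exact Or.inl ⟨⟨m, by omega⟩, Fin.ext (by rw [oddPos_val, hm])⟩
  · exact Or.inr ⟨⟨m, by omega⟩, Fin.ext (by rw [evenPos_val, hm])⟩

/-- The partition of `2 n` points obtained by drawing `π` on the odd places and `σ` on the even
places. It may have crossings. -/
def interleave {n : ℕ} (π σ : Finpartition (Finset.univ : Finset (Fin n))) :
    Finpartition (Finset.univ : Finset (Fin (2 * n))) :=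
  Finpartition.ofExistsUnique
    (π.parts.image (fun V => V.map oddPos) ∪ σ.parts.image (fun V => V.map evenPos))
    (fun _ _ => Finset.subset_univ _)
    (by
      intro x _
      rcases exists_pos x with ⟨i, rfl⟩ | ⟨i, rfl⟩
      · obtain ⟨V, ⟨hV, hi⟩, huniq⟩ := π.existsUnique_mem (Finset.mem_univ i)
        refine ⟨V.map oddPos, ⟨Finset.mem_union_left _ (Finset.mem_image_of_mem _ hV),
          Finset.mem_map_of_mem _ hi⟩, ?_⟩
        rintro U ⟨hU, hiU⟩
        rcases Finset.mem_union.1 hU with h | h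
        · obtain ⟨W, hW, rfl⟩ := Finset.mem_image.1 h
          rw [huniq W ⟨hW, (Finset.mem_map' _).1 hiU⟩]
        · obtain ⟨W, hW, rfl⟩ := Finset.mem_image.1 h
          obtain ⟨j, _, hj⟩ := Finset.mem_map.1 hiU
          exact absurd hj.symm (oddPos_ne_evenPos _ _)
      · obtain ⟨V, ⟨hV, hi⟩, huniq⟩ := σ.existsUnique_mem (Finset.mem_univ i)
        refine ⟨V.map evenPos, ⟨Finset.mem_union_right _ (Finset.mem_image_of_mem _ hV),
          Finset.mem_map_of_mem _ hi⟩, ?_⟩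
        rintro U ⟨hU, hiU⟩
        rcases Finset.mem_union.1 hU with h | h
        · obtain ⟨W, hW, rfl⟩ := Finset.mem_image.1 h
          obtain ⟨j, _, hj⟩ := Finset.mem_map.1 hiU
          exact absurd hj (oddPos_ne_evenPos _ _)
        · obtain ⟨W, hW, rfl⟩ := Finset.mem_image.1 h
          rw [huniq W ⟨hW, (Finset.mem_map' _).1 hiU⟩])
    (by
      intro h
      rcases Finset.mem_union.1 h with h | h
      · obtain ⟨W, hW, hW'⟩ := Finset.mem_image.1 h
        exact π.ne_empty hW (Finset.map_eq_empty.1 hW')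
      · obtain ⟨W, hW, hW'⟩ := Finset.mem_image.1 h
        exact σ.ne_empty hW (Finset.map_eq_empty.1 hW'))

theorem mem_interleave {n : ℕ} {π σ : Finpartition (Finset.univ : Finset (Fin n))}
    {U : Finset (Fin (2 * n))} :
    U ∈ (interleave π σ).parts ↔
      (∃ V ∈ π.parts, V.map oddPos = U) ∨ (∃ V ∈ σ.parts, V.map evenPos = U) := by
  simp [interleave]

/-- `i` and `j` are not separated by `π` if the blocks of `π` do not cross the interval between
`i` (excluded) and `j` (included). -/
def complSetoid {n : ℕ} (π : Finpartition (Finset.univ : Finset (Fin n))) : Setoid (Fin n) where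
  r i j := ∀ V ∈ π.parts, ∀ p ∈ V, ∀ q ∈ V, ((p ≤ i ↔ p ≤ j) ↔ (q ≤ i ↔ q ≤ j))
  iseqv :=
    { refl := fun i V _ p _ q _ => by tauto
      symm := fun h V hV p hp q hq => by have := h V hV p hp q hq; tauto
      trans := fun h h' V hV p hp q hq => by
        have := h V hV p hp q hq
        have := h' V hV p hp q hq
        tauto }

/-- Among the `σ ∈ NC(n)` for which `π ∪ σ` is non-crossing there is a largest one. -/
theorem exists_isGreatest_compl {n : ℕ} (π : NC n) :
    ∃ σ : NC n, IsGreatest {σ : NC n | IsNonCrossing (interleave π.1 σ.1)} σ := by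
  classical
  let K : Finpartition (Finset.univ : Finset (Fin n)) := Finpartition.ofSetoid (complSetoid π.1)
  have hK : ∀ V ∈ K.parts, ∀ i ∈ V, ∀ j, j ∈ V ↔ complSetoid π.1 i j := by
    intro V hV i hi j
    rw [← Finpartition.mem_part_ofSetoid_iff_rel, Finpartition.part_eq_of_mem _ hV hi]
  have hKnc : IsNonCrossing K := by
    intro a b c d hab hbc hcd V hV W hW ha hc hb hd
    have h1 := (hK V hV a ha c).1 hc
    have h2 := (hK W hW b hb d).1 hd
    refine K.eq_of_mem_parts hV hW ((hK V hV a ha b).2 ?_) hb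
    intro U hU p hp q hq
    have h1' := h1 U hU p hp q hq
    have h2' := h2 U hU p hp q hq
    simp only [Fin.lt_def, Fin.le_def] at *
    omega
  refine ⟨⟨K, hKnc⟩, ?_, ?_⟩
  · intro a b c d hab hbc hcd V hV W hW ha hc hb hd
    rcases mem_interleave.1 hV with ⟨V, hV', rfl⟩ | ⟨V, hV', rfl⟩ <;>
    rcases mem_interleave.1 hW with ⟨W, hW', rfl⟩ | ⟨W, hW', rfl⟩ <;>
    obtain ⟨a, ha', rfl⟩ := Finset.mem_map.1 ha <;>
    obtain ⟨b, hb', rfl⟩ := Finset.mem_map.1 hb <;>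
    obtain ⟨c, hc', rfl⟩ := Finset.mem_map.1 hc <;>
    obtain ⟨d, hd', rfl⟩ := Finset.mem_map.1 hd <;>
    simp only [Fin.lt_def, oddPos_val, evenPos_val] at hab hbc hcd
    · rw [π.2 a b c d (Fin.lt_def.2 (by omega)) (Fin.lt_def.2 (by omega))
        (Fin.lt_def.2 (by omega)) V hV' W hW' ha' hc' hb' hd']
    · have := (hK W hW' b hb' d).1 hd' V hV' a ha' c hc'
      simp only [Fin.le_def] at this
      omega
    · have := (hK V hV' a ha' c).1 hc' W hW' b hb' d hd'
      simp only [Fin.le_def] at this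
      omega
    · rw [hKnc a b c d (Fin.lt_def.2 (by omega)) (Fin.lt_def.2 (by omega))
        (Fin.lt_def.2 (by omega)) V hV' W hW' ha' hc' hb' hd']
  · intro σ hσ V hV
    obtain ⟨i, hi⟩ := σ.1.nonempty_of_mem_parts hV
    refine ⟨K.part i, K.part_mem.2 (Finset.mem_univ _), ?_⟩
    intro j hj
    refine (hK (K.part i) (K.part_mem.2 (Finset.mem_univ _)) i
      (K.mem_part (Finset.mem_univ _)) j).2 ?_
    have hne : ∀ U : Finset (Fin n), U ∈ π.1.parts → U.map oddPos ≠ V.map evenPos := by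
      intro U hU h
      have := h ▸ Finset.mem_map_of_mem evenPos hi
      obtain ⟨q, _, hq⟩ := Finset.mem_map.1 this
      exact oddPos_ne_evenPos _ _ hq
    -- no block of `π` separates the points `x < y` of `V`
    have key : ∀ x ∈ V, ∀ y ∈ V, ∀ U ∈ π.1.parts, ∀ p ∈ U, ∀ q ∈ U,
        ¬ (x < p ∧ p ≤ y ∧ (q ≤ x ∨ y < q)) := by
      rintro x hx y hy U hU p hp q hq ⟨hxp, hpy, hq'⟩
      have hU' : U.map oddPos ∈ (interleave π.1 σ.1).parts :=
        mem_interleave.2 (Or.inl ⟨U, hU, rfl⟩)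
      have hV' : V.map evenPos ∈ (interleave π.1 σ.1).parts :=
        mem_interleave.2 (Or.inr ⟨V, hV, rfl⟩)
      have hp' := Finset.mem_map_of_mem oddPos hp
      have hq'' := Finset.mem_map_of_mem oddPos hq
      have hx' := Finset.mem_map_of_mem evenPos hx
      have hy' := Finset.mem_map_of_mem evenPos hy
      simp only [Fin.lt_def, Fin.le_def] at hxp hpy hq'
      rcases hq' with h | h
      · refine hne U hU (hσ (oddPos q) (evenPos x) (oddPos p) (evenPos y) ?_ ?_ ?_
          _ hU' _ hV' hq'' hp' hx' hy') <;>
        simp only [Fin.lt_def, oddPos_val, evenPos_val] <;> omega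
      · refine hne U hU (hσ (evenPos x) (oddPos p) (evenPos y) (oddPos q) ?_ ?_ ?_
          _ hV' _ hU' hx' hy' hp' hq'').symm <;>
        simp only [Fin.lt_def, oddPos_val, evenPos_val] <;> omega
    intro U hU p hp q hq
    have k1 := key i hi j hj U hU p hp q hq
    have k2 := key i hi j hj U hU q hq p hp
    have k3 := key j hj i hi U hU p hp q hq
    have k4 := key j hj i hi U hU q hq p hp
    simp only [Fin.lt_def, Fin.le_def] at *
    omega

/-- The Kreweras complement `Kr(π) = max {σ ∈ NC(n) : π ∪ σ ∈ NC(2n)}`. -/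
noncomputable def kreweras {n : ℕ} (π : NC n) : NC n :=
  (exists_isGreatest_compl π).choose

theorem kreweras_isGreatest {n : ℕ} (π : NC n) :
    IsGreatest {σ : NC n | IsNonCrossing (interleave π.1 σ.1)} (kreweras π) :=
  (exists_isGreatest_compl π).choose_spec

/-- The `k`-equal non-crossing partitions of `k n` points: all blocks have size exactly `k`. -/
def NCEqual (k n : ℕ) : Finset (NC (n * k)) :=
  Finset.univ.filter fun π => ∀ V ∈ π.1.parts, V.card = k

/-- The `k`-divisible non-crossing partitions of `k n` points: all block sizes are multiples
of `k`. -/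
def NCDivisible (k n : ℕ) : Finset (NC (n * k)) :=
  Finset.univ.filter fun π => ∀ V ∈ π.1.parts, k ∣ V.card

end Partitions

section Cumulants

variable {A : Type*} [Ring A] [Algebra ℂ A]

/-- `f_π(a_1, …, a_n) = ∏_{V ∈ π} f_{|V|}(a_{m_1}, …, a_{m_{|V|}})`, where `m_1 < ⋯ < m_{|V|}` are
the elements of the block `V`. -/
noncomputable def blockProd (f : (n : ℕ) → (Fin n → A) → ℂ) {n : ℕ} (π : NC n)
    (a : Fin n → A) : ℂ :=
  ∏ V ∈ π.1.parts, f V.card (fun j => a (V.orderEmbOfFin rfl j))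

theorem card_lt_of_ne_univ {n : ℕ} {P : Finset (Finset (Fin n))} (hP : Finset.univ ∉ P)
    {V : Finset (Fin n)} (hV : V ∈ P) : V.card < n := by
  have h : V ≠ Finset.univ := fun h => hP (h ▸ hV)
  have := Finset.card_lt_univ_of_notMem (s := V)
    (x := (not_forall.1 fun h' => h (Finset.eq_univ_iff_forall.2 h')).choose)
    (not_forall.1 fun h' => h (Finset.eq_univ_iff_forall.2 h')).choose_spec
  simpa using this

/-- The free cumulants `κ_n`, `n ≥ 1`, obtained by solving the moment-cumulant formula
`τ(a_1 ⋯ a_n) = ∑_{π ∈ NC(n)} κ_π(a_1, …, a_n)` recursively for the term of `π = 1_n`: the sum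
below runs over the `π ∈ NC(n)` that do not have the one block `{1, …, n}`. -/
noncomputable def freeCumulant (τ : A →ₗ[ℂ] ℂ) (n : ℕ) (a : Fin n → A) : ℂ :=
  τ (List.ofFn a).prod -
    ∑ π : {π : NC n // Finset.univ ∉ π.1.parts}, ∏ V : {V // V ∈ π.1.1.parts},
      freeCumulant τ V.1.card (fun j => a (V.1.orderEmbOfFin rfl j))
termination_by n
decreasing_by exact card_lt_of_ne_univ π.2 V.2

/-- The moment-cumulant formula. -/
theorem moment_eq_sum_freeCumulant (τ : A →ₗ[ℂ] ℂ) {n : ℕ} (hn : 1 ≤ n) (a : Fin n → A) :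
    τ (List.ofFn a).prod = ∑ π : NC n, blockProd (freeCumulant τ) π a := by
  classical
  have hne : (Finset.univ : Finset (Fin n)) ≠ ∅ :=
    Finset.nonempty_iff_ne_empty.1 ⟨⟨0, hn⟩, Finset.mem_univ _⟩
  let T : NC n := ⟨Finpartition.indiscrete hne, by
    intro a b c d _ _ _ V hV W hW _ _ _ _
    rw [Finpartition.indiscrete_parts, Finset.mem_singleton] at hV hW
    rw [hV, hW]⟩
  have hT : ∀ π : NC n, Finset.univ ∉ π.1.parts ↔ π ≠ T := by
    intro π
    constructor
    · rintro h rfl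
      exact h (Finset.mem_singleton_self _)
    · intro h h'
      refine h (Subtype.ext (Finpartition.ext ?_))
      ext V
      simp only [T, Finpartition.indiscrete_parts, Finset.mem_singleton]
      refine ⟨fun hV => ?_, fun hV => hV ▸ h'⟩
      obtain ⟨x, hx⟩ := π.1.nonempty_of_mem_parts hV
      exact π.1.eq_of_mem_parts hV h' hx (Finset.mem_univ _)
  have hTv : blockProd (freeCumulant τ) T a = freeCumulant τ n a := by
    have hgen : ∀ (m : ℕ) (h : (Finset.univ : Finset (Fin n)).card = m),
        freeCumulant τ m (fun j => a ((Finset.univ : Finset (Fin n)).orderEmbOfFin h j)) =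
          freeCumulant τ n a := by
      intro m h
      obtain rfl : n = m := by simpa using h
      congr 1
      funext j
      congr 1
      have := Finset.orderEmbOfFin_unique (s := (Finset.univ : Finset (Fin n))) h
        (f := id) (fun x => Finset.mem_univ _) strictMono_id
      exact (congrFun this j).symm
    simp only [blockProd, T, Finpartition.indiscrete_parts, Finset.prod_singleton]
    exact hgen _ rfl
  rw [← Finset.add_sum_erase _ _ (Finset.mem_univ T), hTv]
  conv_rhs => rw [freeCumulant]
  have hsum : ∑ π : {π : NC n // Finset.univ ∉ π.1.parts}, ∏ V : {V // V ∈ π.1.1.parts},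
      freeCumulant τ V.1.card (fun j => a (V.1.orderEmbOfFin rfl j)) =
      ∑ π ∈ Finset.univ.erase T, blockProd (freeCumulant τ) π a := by
    rw [Finset.sum_subtype (p := fun π : NC n => Finset.univ ∉ π.1.parts) (Finset.univ.erase T)
      (fun π => by simp [hT π])]
    refine Finset.sum_congr rfl fun π _ => ?_
    rw [blockProd]
    exact Finset.prod_coe_sort π.1.1.parts
      (fun V => freeCumulant τ V.card (fun j => a (V.orderEmbOfFin rfl j)))
  rw [hsum]
  ring

/-- The variables `a_1, …, a_k` are free: all mixed free cumulants vanish, that is,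
`κ_n(a_{i_1}, …, a_{i_n}) = 0` unless `i_1 = i_2 = ⋯ = i_n`. -/
def IsFree (τ : A →ₗ[ℂ] ℂ) {k : ℕ} (a : Fin k → A) : Prop :=
  ∀ (n : ℕ) (i : Fin n → Fin k), ¬ (∀ p q, i p = i q) → freeCumulant τ n (fun p => a (i p)) = 0

end Cumulants

section Spaces

open scoped ComplexOrder

/-- `(A, τ)` is a `C*`-probability space: the linear functional `τ` on the unital `C*`-algebra `A`
is positive and unital. -/
structure IsState {A : Type*} [CStarAlgebra A] (τ : A →ₗ[ℂ] ℂ) : Prop where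
  nonneg : ∀ x : A, 0 ≤ τ (star x * x)
  map_one : τ 1 = 1

end Spaces

end FreeProb

/-! Expand `τ (a ^ n)` by the moment-cumulant formula as a sum over all σ in NC(nk), the nk letters
falling into n consecutive groups of k letters, one group for each factor a. Both formulas follow by
combining two independent facts.

Cumulants of products, without freeness: the blocks of σ link groups, and the resulting connected
components form a partition ρ of the n groups that is again non-crossing (`nonCrossing_components`).
Conversely, σ amounts to an independent choice, over each block of ρ, of a non-crossing partition
connecting it (`sum_nonCrossing_eq_sum_components`). So `τ (a ^ n)` is a sum over ρ of products of
numbers that depend on block sizes only. Such expansions determine the numbers (`eq_of_sum_nc_eq`),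
hence κ_n(a) is the sum over those σ that connect all n groups (`freeCumulant_prod`).

Kreweras complement: freeness kills every σ with a block containing different residues mod k. Write
σ = Kr(π), which is legitimate by `kreweras_bijective`. For i ≤ j, the points i and j share a block
of Kr(π) exactly when (i, j] is a union of blocks of π; comparing lengths, residues are constant on
the blocks of Kr(π) iff k divides all block sizes of π (`dvd_card_iff_mod_eq`). Among these π,
connecting all groups means having only blocks of size k (`card_eq_of_isConnectedOn`,
`isConnectedOn_of_card_eq`): two first points of groups in one block of π cut off a range of groups
that Kr(π) does not leave, and a gap in a component produces two such points. -/

namespace FreeProb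

/-! ### Connected components of a non-crossing partition over a monotone map -/

section Components

/-- A family of subsets of a linear order is non-crossing if `a < b < c < d`, `a, c ∈ V` and
`b, d ∈ W` for two members `V`, `W` force `V = W`. -/
def NonCrossing {α : Type*} [LinearOrder α] (P : Finset (Finset α)) : Prop :=
  ∀ a b c d : α, a < b → b < c → c < d → ∀ V ∈ P, ∀ W ∈ P,
    a ∈ V → c ∈ V → b ∈ W → d ∈ W → V = W

variable {α β : Type*} [LinearOrder α] [LinearOrder β]

/-- The preimage of `S` under `f` is a union of blocks of `σ`. -/
def IsSaturated (f : α → β) {s : Finset α} (σ : Finpartition s) (S : Finset β) : Prop :=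
  ∀ U ∈ σ.parts, ∀ x ∈ U, ∀ y ∈ U, f x ∈ S → f y ∈ S

/-- The set `T` is connected by the images of the blocks of `σ` under `f`. -/
def IsConnectedOn (f : α → β) {s : Finset α} (σ : Finpartition s) (T : Finset β) : Prop :=
  ∀ S ⊆ T, S.Nonempty → IsSaturated f σ S → S = T

theorem IsSaturated.inter {f : α → β} {s : Finset α} {σ : Finpartition s} {S T : Finset β}
    (h : IsSaturated f σ S) (h' : IsSaturated f σ T) : IsSaturated f σ (S ∩ T) := by
  intro U hU x hx y hy hxS
  rw [Finset.mem_inter] at hxS ⊢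
  exact ⟨h U hU x hx y hy hxS.1, h' U hU x hx y hy hxS.2⟩

/-- Restricting to the preimage of a saturated set cuts no block: a block that meets the preimage
lies inside it. -/
theorem mem_restrict_of_isSaturated [Fintype α] {f : α → β}
    {σ : Finpartition (Finset.univ : Finset α)}
    {V : Finset β} (hV : IsSaturated f σ V) {U : Finset α} :
    U ∈ (σ.restrict (Finset.subset_univ (Finset.univ.filter fun x => f x ∈ V))).parts ↔
      U ∈ σ.parts ∧ ∀ x ∈ U, f x ∈ V := by
  have hcap : ∀ W ∈ σ.parts, ∀ x ∈ W, f x ∈ V →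
      W ∩ (Finset.univ.filter fun x => f x ∈ V) = W := by
    intro W hW x hx hxV
    refine Finset.inter_eq_left.2 fun y hy => ?_
    simpa using hV W hW x hx y hy hxV
  simp only [Finpartition.restrict, Finset.mem_erase, Finset.mem_image, Finset.inf_eq_inter,
    Finset.bot_eq_empty]
  constructor
  · rintro ⟨hne, W, hW, rfl⟩
    obtain ⟨x, hx⟩ := Finset.nonempty_iff_ne_empty.2 hne
    simp only [Finset.mem_inter, Finset.mem_filter, Finset.mem_univ, true_and] at hx
    rw [hcap W hW x hx.1 hx.2]
    exact ⟨hW, fun y hy => hV W hW x hx.1 y hy hx.2⟩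
  · rintro ⟨hU, h⟩
    obtain ⟨x, hx⟩ := σ.nonempty_of_mem_parts hU
    exact ⟨σ.ne_empty hU, U, hU, hcap U hU x hx (h x hx)⟩

theorem isConnectedOn_restrict [Fintype α] {f : α → β}
    {σ : Finpartition (Finset.univ : Finset α)}
    {V : Finset β} (hV : IsSaturated f σ V) :
    IsConnectedOn f (σ.restrict (Finset.subset_univ (Finset.univ.filter fun x => f x ∈ V))) V ↔
      IsConnectedOn f σ V := by
  refine forall₃_congr fun S hS _ => ?_
  have : IsSaturated f (σ.restrict
      (Finset.subset_univ (Finset.univ.filter fun x => f x ∈ V))) S ↔ IsSaturated f σ S := by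
    constructor
    · intro h U hU x hx y hy hxS
      exact h U ((mem_restrict_of_isSaturated hV).2
        ⟨hU, fun z hz => hV U hU x hx z hz (hS hxS)⟩) x hx y hy hxS
    · intro h U hU
      exact h U ((mem_restrict_of_isSaturated hV).1 hU).1
  rw [this]

variable [Fintype β]

theorem IsSaturated.compl {f : α → β} {s : Finset α} {σ : Finpartition s} {S : Finset β}
    (h : IsSaturated f σ S) : IsSaturated f σ Sᶜ := by
  intro U hU x hx y hy hxS
  rw [Finset.mem_compl] at hxS ⊢
  exact fun hyS => hxS (h U hU y hy x hx hyS)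

/-- Two points are equivalent if no saturated set separates them. -/
def componentSetoid (f : α → β) {s : Finset α} (σ : Finpartition s) : Setoid β where
  r i j := ∀ S, IsSaturated f σ S → i ∈ S → j ∈ S
  iseqv :=
    { refl := fun _ _ _ h => h
      symm := fun {i j} h S hS hj => by
        by_contra hi
        exact Finset.mem_compl.1 (h _ hS.compl (Finset.mem_compl.2 hi)) hj
      trans := fun h h' S hS hi => h' S hS (h S hS hi) }

open Classical in
/-- The partition of `β` into the connected components of the images of the blocks of `σ`. -/
noncomputable def components (f : α → β) {s : Finset α} (σ : Finpartition s) :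
    Finpartition (Finset.univ : Finset β) :=
  Finpartition.ofSetoid (componentSetoid f σ)

theorem mem_iff_of_mem_components {f : α → β} {s : Finset α} {σ : Finpartition s}
    {V : Finset β} (hV : V ∈ (components f σ).parts) {i : β} (hi : i ∈ V) (j : β) :
    j ∈ V ↔ ∀ S, IsSaturated f σ S → i ∈ S → j ∈ S := by
  classical
  rw [← Finpartition.part_eq_of_mem _ hV hi]
  exact Finpartition.mem_part_ofSetoid_iff_rel (s := componentSetoid f σ)

theorem isSaturated_of_mem_components {f : α → β} {s : Finset α} {σ : Finpartition s}
    {V : Finset β} (hV : V ∈ (components f σ).parts) : IsSaturated f σ V := by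
  intro U hU x hx y hy hxV
  rw [mem_iff_of_mem_components hV hxV]
  exact fun S hS => hS U hU x hx y hy

theorem isConnectedOn_of_mem_components {f : α → β} {s : Finset α} {σ : Finpartition s}
    {V : Finset β} (hV : V ∈ (components f σ).parts) : IsConnectedOn f σ V := by
  rintro S hSV ⟨i, hi⟩ hS
  refine Finset.Subset.antisymm hSV fun j hj => ?_
  exact (mem_iff_of_mem_components hV (hSV hi) j).1 hj S hS hi

/-- Describes the fibres of `components`. A component and a block of ρ through a common point meet
in a saturated set, which by connectedness equals both. -/
theorem components_eq_iff {f : α → β} {s : Finset α} {σ : Finpartition s}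
    {ρ : Finpartition (Finset.univ : Finset β)} :
    components f σ = ρ ↔ ∀ V ∈ ρ.parts, IsSaturated f σ V ∧ IsConnectedOn f σ V := by
  constructor
  · rintro rfl V hV
    exact ⟨isSaturated_of_mem_components hV, isConnectedOn_of_mem_components hV⟩
  · intro h
    have key : ∀ i : β, (components f σ).part i = ρ.part i := by
      intro i
      have h1 : (components f σ).part i ∈ (components f σ).parts :=
        Finpartition.part_mem _ |>.2 (Finset.mem_univ i)
      have h2 : ρ.part i ∈ ρ.parts := Finpartition.part_mem _ |>.2 (Finset.mem_univ i)
      have i1 : i ∈ (components f σ).part i := Finpartition.mem_part _ (Finset.mem_univ i)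
      have i2 : i ∈ ρ.part i := Finpartition.mem_part _ (Finset.mem_univ i)
      have hs := (isSaturated_of_mem_components h1).inter (h _ h2).1
      have hne : ((components f σ).part i ∩ ρ.part i).Nonempty :=
        ⟨i, Finset.mem_inter.2 ⟨i1, i2⟩⟩
      rw [← (h _ h2).2 _ Finset.inter_subset_right hne hs,
        isConnectedOn_of_mem_components h1 _ Finset.inter_subset_left hne hs]
    refine Finpartition.ext (Finset.ext fun V => ⟨fun hV => ?_, fun hV => ?_⟩)
    · obtain ⟨i, hi⟩ := Finpartition.nonempty_of_mem_parts _ hV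
      rw [← Finpartition.part_eq_of_mem _ hV hi, key]
      exact Finpartition.part_mem _ |>.2 (Finset.mem_univ i)
    · obtain ⟨i, hi⟩ := Finpartition.nonempty_of_mem_parts _ hV
      rw [← Finpartition.part_eq_of_mem _ hV hi, ← key]
      exact Finpartition.part_mem _ |>.2 (Finset.mem_univ i)

/-- Otherwise the part of V satisfying p would be a proper nonempty saturated subset of V. -/
theorem exists_block_leaving {f : α → β} {s : Finset α} {σ : Finpartition s} {V : Finset β}
    (hV : V ∈ (components f σ).parts) (p : β → Prop) {i j : β} (hi : i ∈ V) (hj : j ∈ V)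
    (hpi : p i) (hpj : ¬ p j) :
    ∃ U ∈ σ.parts, ∃ x ∈ U, ∃ y ∈ U, f x ∈ V ∧ f y ∈ V ∧ p (f x) ∧ ¬ p (f y) := by
  classical
  by_contra! hcon
  have h : V.filter p = V := by
    refine isConnectedOn_of_mem_components hV _ (Finset.filter_subset _ _)
      ⟨i, Finset.mem_filter.2 ⟨hi, hpi⟩⟩ ?_
    intro U hU x hx y hy hxV
    rw [Finset.mem_filter] at hxV ⊢
    have hy' := isSaturated_of_mem_components hV U hU x hx y hy hxV.1
    exact ⟨hy', hcon U hU x hx y hy hxV.1 hy' hxV.2⟩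
  rw [← h] at hj
  exact hpj (Finset.mem_filter.1 hj).2

/-- A crossing of components descends to blocks: some block over W leaves the interval (a, c), and
then some block over V leaves the interval spanned by two image points of that block. These two
blocks cross. -/
theorem nonCrossing_components {f : α → β} (hf : Monotone f) {s : Finset α}
    {σ : Finpartition s} (hσ : NonCrossing σ.parts) : NonCrossing (components f σ).parts := by
  intro a b c d hab hbc hcd V hV W hW ha hc hb hd
  by_contra hVW
  have hdisj : ∀ i ∈ V, ∀ j ∈ W, i ≠ j := by
    rintro i hi _ hj rfl
    exact hVW (Finpartition.eq_of_mem_parts _ hV hW hi hj)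
  have lt_of : ∀ {x y : α}, f x < f y → x < y := fun h => lt_of_not_ge fun h' => h.not_ge (hf h')
  -- Crossing blocks coincide, and a single block cannot lie over both V and W.
  have hcross : ∀ x y z t : α, f x < f y → f y < f z → f z < f t → ∀ U ∈ σ.parts,
      ∀ U' ∈ σ.parts, x ∈ U → z ∈ U → y ∈ U' → t ∈ U' → f x ∈ V ∧ f y ∈ W ∨
      f x ∈ W ∧ f y ∈ V → False := by
    intro x y z t hxy hyz hzt U hU U' hU' hx hz hy ht h
    have hUU := hσ x y z t (lt_of hxy) (lt_of hyz) (lt_of hzt) U hU U' hU' hx hz hy ht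
    subst hUU
    rcases h with ⟨h1, h2⟩ | ⟨h1, h2⟩
    · exact hdisj _ (isSaturated_of_mem_components hV U hU x hx y hy h1) _ h2 rfl
    · exact hdisj _ h2 _ (isSaturated_of_mem_components hW U hU x hx y hy h1) rfl
  obtain ⟨U, hU, y, hy, y', hy', hyW, hy'W, hin, hout⟩ :=
    exists_block_leaving hW (fun i => a < i ∧ i < c) hb hd ⟨hab, hbc⟩
      (fun h => h.2.not_gt hcd)
  have hy'a := hdisj a ha _ hy'W
  have hy'c := hdisj c hc _ hy'W
  -- The block over W exits (a, c) beyond c or before a; the two cases are mirror images.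
  rcases lt_or_gt_of_ne hy'a with h | h
  · have h' : c < f y' := lt_of_le_of_ne (le_of_not_gt fun h' => hout ⟨h, h'⟩) hy'c
    obtain ⟨U', hU', x, hx, x', hx', hxV, hx'V, hin', hout'⟩ :=
      exists_block_leaving hV (fun i => f y < i ∧ i < f y') hc ha ⟨hin.2, h'⟩
        (fun h => h.1.not_gt hin.1)
    have h1 := hdisj _ hx'V _ hyW
    have h2 := hdisj _ hx'V _ hy'W
    rcases lt_or_gt_of_ne h1 with h3 | h3
    · exact hcross x' y x y' h3 hin'.1 hin'.2 U' hU' U hU hx' hx hy hy' (Or.inl ⟨hx'V, hyW⟩)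
    · have h4 : f y' < f x' := lt_of_le_of_ne (le_of_not_gt fun h' => hout' ⟨h3, h'⟩) h2.symm
      exact hcross y x y' x' hin'.1 hin'.2 h4 U hU U' hU' hy hy' hx hx' (Or.inr ⟨hyW, hxV⟩)
  · obtain ⟨U', hU', x, hx, x', hx', hxV, hx'V, hin', hout'⟩ :=
      exists_block_leaving hV (fun i => f y' < i ∧ i < f y) ha hc ⟨h, hin.1⟩
        (fun h => h.2.not_gt hin.2)
    have h1 := hdisj _ hx'V _ hyW
    have h2 := hdisj _ hx'V _ hy'W
    rcases lt_or_gt_of_ne h2 with h3 | h3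
    · exact hcross x' y' x y h3 hin'.1 hin'.2 U' hU' U hU hx' hx hy' hy (Or.inl ⟨hx'V, hy'W⟩)
    · have h4 : f y < f x' := lt_of_le_of_ne (le_of_not_gt fun h' => hout' ⟨h3, h'⟩) h1.symm
      exact hcross y' x y x' hin'.1 hin'.2 h4 U hU U' hU' hy' hy hx hx' (Or.inr ⟨hy'W, hxV⟩)

variable [Fintype α]

/-- Partitions of the preimages of the blocks of `ρ` form a partition of `α`. -/
def glue (f : α → β) (ρ : Finpartition (Finset.univ : Finset β))
    (p : ∀ V ∈ ρ.parts, Finpartition (Finset.univ.filter fun x : α => f x ∈ V)) :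
    Finpartition (Finset.univ : Finset α) :=
  Finpartition.ofExistsUnique (ρ.parts.attach.biUnion fun V => (p V.1 V.2).parts)
    (fun _ _ => Finset.subset_univ _)
    (by
      intro x _
      obtain ⟨V, ⟨hV, hxV⟩, hVu⟩ := ρ.existsUnique_mem (Finset.mem_univ (f x))
      obtain ⟨U, ⟨hU, hxU⟩, hUu⟩ := (p V hV).existsUnique_mem (a := x) (by simpa using hxV)
      refine ⟨U, ⟨Finset.mem_biUnion.2 ⟨⟨V, hV⟩, Finset.mem_attach _ _, hU⟩, hxU⟩, ?_⟩
      rintro U' ⟨hU', hxU'⟩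
      obtain ⟨⟨V', hV'⟩, -, hUV'⟩ := Finset.mem_biUnion.1 hU'
      have := (p V' hV').subset hUV' hxU'
      obtain rfl := hVu V' ⟨hV', by simpa using this⟩
      exact hUu U' ⟨hUV', hxU'⟩)
    (by
      intro h
      obtain ⟨⟨V', hV'⟩, -, h⟩ := Finset.mem_biUnion.1 h
      exact Finpartition.empty_notMem_parts _ h)

theorem glue_parts (f : α → β) (ρ : Finpartition (Finset.univ : Finset β))
    (p : ∀ V ∈ ρ.parts, Finpartition (Finset.univ.filter fun x : α => f x ∈ V)) :
    (glue f ρ p).parts = ρ.parts.attach.biUnion fun V => (p V.1 V.2).parts := rfl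

theorem mem_glue {f : α → β} {ρ : Finpartition (Finset.univ : Finset β)}
    {p : ∀ V ∈ ρ.parts, Finpartition (Finset.univ.filter fun x : α => f x ∈ V)}
    {U : Finset α} : U ∈ (glue f ρ p).parts ↔ ∃ V, ∃ hV : V ∈ ρ.parts, U ∈ (p V hV).parts := by
  simp [glue_parts]

theorem mem_glue_iff {f : α → β} {ρ : Finpartition (Finset.univ : Finset β)}
    {p : ∀ V ∈ ρ.parts, Finpartition (Finset.univ.filter fun x : α => f x ∈ V)}
    {U V : Finset _} (hV : V ∈ ρ.parts) {x : α} (hx : x ∈ U) (hxV : f x ∈ V) :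
    U ∈ (glue f ρ p).parts ↔ U ∈ (p V hV).parts := by
  rw [mem_glue]
  refine ⟨?_, fun h => ⟨V, hV, h⟩⟩
  rintro ⟨W, hW, h⟩
  have hxW := (p W hW).subset h hx
  obtain rfl := ρ.eq_of_mem_parts hV hW hxV (by simpa using hxW)
  exact h

theorem isSaturated_glue (f : α → β) (ρ : Finpartition (Finset.univ : Finset β))
    (p : ∀ V ∈ ρ.parts, Finpartition (Finset.univ.filter fun x : α => f x ∈ V))
    {V : Finset β} (hV : V ∈ ρ.parts) : IsSaturated f (glue f ρ p) V := by
  intro U hU x hx y hy hxV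
  have := (p V hV).subset ((mem_glue_iff hV hx hxV).1 hU) hy
  simpa using this

theorem restrict_glue (f : α → β) (ρ : Finpartition (Finset.univ : Finset β))
    (p : ∀ V ∈ ρ.parts, Finpartition (Finset.univ.filter fun x : α => f x ∈ V))
    {V : Finset β} (hV : V ∈ ρ.parts) :
    (glue f ρ p).restrict (Finset.subset_univ (Finset.univ.filter fun x => f x ∈ V)) =
      p V hV := by
  refine Finpartition.ext (Finset.ext fun U => ?_)
  rw [mem_restrict_of_isSaturated (isSaturated_glue f ρ p hV)]
  constructor
  · rintro ⟨hU, h⟩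
    obtain ⟨x, hx⟩ := Finpartition.nonempty_of_mem_parts _ hU
    exact (mem_glue_iff hV hx (h x hx)).1 hU
  · intro hU
    refine ⟨mem_glue.2 ⟨V, hV, hU⟩, fun x hx => ?_⟩
    simpa using (p V hV).subset hU hx

theorem glue_restrict {f : α → β} {ρ : Finpartition (Finset.univ : Finset β)}
    {σ : Finpartition (Finset.univ : Finset α)} (h : ∀ V ∈ ρ.parts, IsSaturated f σ V) :
    (glue f ρ fun V _ =>
      σ.restrict (Finset.subset_univ (Finset.univ.filter fun x => f x ∈ V))) = σ := by
  refine Finpartition.ext (Finset.ext fun U => ?_)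
  rw [mem_glue]
  constructor
  · rintro ⟨V, hV, hU⟩
    exact ((mem_restrict_of_isSaturated (h V hV)).1 hU).1
  · intro hU
    obtain ⟨x, hx⟩ := σ.nonempty_of_mem_parts hU
    obtain ⟨V, hV, hxV⟩ := ρ.exists_mem (Finset.mem_univ (f x))
    exact ⟨V, hV, (mem_restrict_of_isSaturated (h V hV)).2
      ⟨hU, fun y hy => h V hV U hU x hx y hy hxV⟩⟩

/-- Points over different blocks of ρ have different images, so a crossing over two blocks stays
strict under f and would be a crossing of ρ. -/
theorem nonCrossing_glue {f : α → β} (hf : Monotone f)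
    {ρ : Finpartition (Finset.univ : Finset β)} (hρ : NonCrossing ρ.parts)
    {p : ∀ V ∈ ρ.parts, Finpartition (Finset.univ.filter fun x : α => f x ∈ V)}
    (hp : ∀ V hV, NonCrossing (p V hV).parts) : NonCrossing (glue f ρ p).parts := by
  intro a b c d hab hbc hcd U hU U' hU' ha hc hb hd
  obtain ⟨V, hV, hUV⟩ := mem_glue.1 hU
  obtain ⟨W, hW, hUW⟩ := mem_glue.1 hU'
  have sub : ∀ {V hV U}, U ∈ (p V hV).parts → ∀ x ∈ U, f x ∈ V := fun h x hx => by
    simpa using (p _ _).subset h hx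
  have hdisj : V ≠ W → ∀ i ∈ V, ∀ j ∈ W, i ≠ j := by
    rintro hne i hi _ hj rfl
    exact hne (ρ.eq_of_mem_parts hV hW hi hj)
  have hVW : V = W := by
    by_contra hne
    have h := hdisj hne
    exact hne (hρ _ _ _ _
      (lt_of_le_of_ne (hf hab.le) (h _ (sub hUV a ha) _ (sub hUW b hb)))
      (lt_of_le_of_ne (hf hbc.le) (h _ (sub hUV c hc) _ (sub hUW b hb)).symm)
      (lt_of_le_of_ne (hf hcd.le) (h _ (sub hUV c hc) _ (sub hUW d hd)))
      V hV W hW (sub hUV a ha) (sub hUV c hc) (sub hUW b hb) (sub hUW d hd))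
  subst hVW
  exact hp V hV a b c d hab hbc hcd U hUV U' hUW ha hc hb hd

open Classical in
/-- Summation over non-crossing partitions according to their connected components. -/
theorem sum_nonCrossing_eq_sum_components {R : Type*} [CommSemiring R] {f : α → β}
    (hf : Monotone f) (w : Finset α → R) :
    ∑ σ : Finpartition (Finset.univ : Finset α) with NonCrossing σ.parts, ∏ U ∈ σ.parts, w U =
      ∑ ρ : Finpartition (Finset.univ : Finset β) with NonCrossing ρ.parts, ∏ V ∈ ρ.parts,
        ∑ σ : Finpartition (Finset.univ.filter fun x : α => f x ∈ V) with
          NonCrossing σ.parts ∧ IsConnectedOn f σ V, ∏ U ∈ σ.parts, w U := by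
  rw [← Finset.sum_fiberwise_of_maps_to (g := components f)
    (t := Finset.univ.filter fun ρ => NonCrossing ρ.parts)
    (fun σ hσ => by simpa using nonCrossing_components hf (Finset.mem_filter.1 hσ).2)]
  refine Finset.sum_congr rfl fun ρ hρ => ?_
  have hρ : NonCrossing ρ.parts := (Finset.mem_filter.1 hρ).2
  -- Expanding the product of sums gives a sum over families with one connecting partition for each
  -- block of ρ; restriction and gluing identify these with the fibre over ρ.
  rw [Finset.prod_sum]
  refine Finset.sum_bij'
    (fun σ _ V _ => σ.restrict (Finset.subset_univ (Finset.univ.filter fun x => f x ∈ V)))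
    (fun p _ => glue f ρ p) ?_ ?_ ?_ ?_ ?_
  · intro σ hσ
    simp only [Finset.mem_filter, Finset.mem_univ, true_and, components_eq_iff] at hσ
    simp only [Finset.mem_pi, Finset.mem_filter, Finset.mem_univ, true_and]
    intro V hV
    refine ⟨?_, (isConnectedOn_restrict (hσ.2 V hV).1).2 (hσ.2 V hV).2⟩
    intro a b c d hab hbc hcd U hU U' hU'
    exact hσ.1 a b c d hab hbc hcd U ((mem_restrict_of_isSaturated (hσ.2 V hV).1).1 hU).1 U'
      ((mem_restrict_of_isSaturated (hσ.2 V hV).1).1 hU').1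
  · intro p hp
    simp only [Finset.mem_pi, Finset.mem_filter, Finset.mem_univ, true_and] at hp
    simp only [Finset.mem_filter, Finset.mem_univ, true_and, components_eq_iff]
    refine ⟨nonCrossing_glue hf hρ fun V hV => (hp V hV).1,
      fun V hV => ⟨isSaturated_glue f ρ p hV, ?_⟩⟩
    rw [← isConnectedOn_restrict (isSaturated_glue f ρ p hV), restrict_glue f ρ p hV]
    exact (hp V hV).2
  · intro σ hσ
    simp only [Finset.mem_filter, Finset.mem_univ, true_and, components_eq_iff] at hσ
    exact glue_restrict fun V hV => (hσ.2 V hV).1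
  · intro p hp
    funext V hV
    exact restrict_glue f ρ p hV
  · intro σ hσ
    simp only [Finset.mem_filter, Finset.mem_univ, true_and, components_eq_iff] at hσ
    conv_lhs => rw [← glue_restrict fun V hV => (hσ.2 V hV).1, glue_parts]
    refine Finset.prod_biUnion ?_
    rintro ⟨V, hV⟩ _ ⟨W, hW⟩ _ hne
    refine Finset.disjoint_left.2 fun U hU hU' => hne (Subtype.ext ?_)
    have h1 := (mem_restrict_of_isSaturated (hσ.2 V hV).1).1 hU
    have h2 := (mem_restrict_of_isSaturated (hσ.2 W hW).1).1 hU'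
    obtain ⟨x, hx⟩ := σ.nonempty_of_mem_parts h1.1
    exact ρ.eq_of_mem_parts hV hW (h1.2 x hx) (h2.2 x hx)

end Components

/-! ### Transport of partitions along order embeddings -/

section Transport

variable {α γ : Type*} [LinearOrder α] [LinearOrder γ] [Fintype γ]

/-- Transport of a partition along an order embedding with range `s`. -/
def mapEmbedding (e : γ ↪o α) {s : Finset α} (hs : ∀ x, x ∈ s ↔ ∃ y, e y = x)
    (σ : Finpartition (Finset.univ : Finset γ)) : Finpartition s :=
  Finpartition.ofExistsUnique (σ.parts.image fun U => U.map e.toEmbedding)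
    (by
      intro U hU x hx
      obtain ⟨W, -, rfl⟩ := Finset.mem_image.1 hU
      obtain ⟨y, -, rfl⟩ := Finset.mem_map.1 hx
      exact (hs _).2 ⟨y, rfl⟩)
    (by
      intro x hx
      obtain ⟨y, rfl⟩ := (hs x).1 hx
      obtain ⟨U, ⟨hU, hyU⟩, hu⟩ := σ.existsUnique_mem (Finset.mem_univ y)
      refine ⟨_, ⟨Finset.mem_image_of_mem _ hU, Finset.mem_map_of_mem _ hyU⟩, ?_⟩
      rintro W ⟨hW, hyW⟩
      obtain ⟨W, hW', rfl⟩ := Finset.mem_image.1 hW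
      rw [hu W ⟨hW', (Finset.mem_map' e.toEmbedding).1 hyW⟩])
    (by
      intro h
      obtain ⟨W, hW, h⟩ := Finset.mem_image.1 h
      exact σ.ne_empty hW (Finset.map_eq_empty.1 h))

theorem mapEmbedding_parts (e : γ ↪o α) {s : Finset α} (hs : ∀ x, x ∈ s ↔ ∃ y, e y = x)
    (σ : Finpartition (Finset.univ : Finset γ)) :
    (mapEmbedding e hs σ).parts = σ.parts.image fun U => U.map e.toEmbedding := rfl

theorem mapEmbedding_bijective (e : γ ↪o α) {s : Finset α} (hs : ∀ x, x ∈ s ↔ ∃ y, e y = x) :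
    Function.Bijective (mapEmbedding e hs) := by
  constructor
  · intro σ τ h
    have h' := congrArg Finpartition.parts h
    rw [mapEmbedding_parts, mapEmbedding_parts] at h'
    exact Finpartition.ext (Finset.image_injective (Finset.map_injective _) h')
  · intro σ
    have hmap : ∀ U ∈ σ.parts,
        (Finset.univ.filter fun y => e y ∈ U).map e.toEmbedding = U := by
      intro U hU
      ext x
      simp only [Finset.mem_map, Finset.mem_filter, Finset.mem_univ, true_and]
      constructor
      · rintro ⟨y, hy, rfl⟩
        exact hy
      · intro hx
        obtain ⟨y, rfl⟩ := (hs x).1 (σ.subset hU hx)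
        exact ⟨y, hx, rfl⟩
    refine ⟨Finpartition.ofExistsUnique
      (σ.parts.image fun U => Finset.univ.filter fun y => e y ∈ U)
      (fun _ _ => Finset.subset_univ _) ?_ ?_, ?_⟩
    · intro y _
      obtain ⟨U, ⟨hU, hyU⟩, hu⟩ := σ.existsUnique_mem ((hs (e y)).2 ⟨y, rfl⟩)
      refine ⟨_, ⟨Finset.mem_image_of_mem _ hU, by simpa using hyU⟩, ?_⟩
      rintro W ⟨hW, hyW⟩
      obtain ⟨W, hW', rfl⟩ := Finset.mem_image.1 hW
      rw [hu W ⟨hW', by simpa using hyW⟩]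
    · intro h
      obtain ⟨W, hW, h⟩ := Finset.mem_image.1 h
      have := hmap W hW
      rw [h, Finset.map_empty] at this
      exact σ.ne_empty hW this.symm
    · refine Finpartition.ext ?_
      rw [mapEmbedding_parts]
      simp only [Finpartition.ofExistsUnique, Finset.image_image]
      exact (Finset.image_congr fun U hU => hmap U hU).trans Finset.image_id

theorem nonCrossing_mapEmbedding (e : γ ↪o α) {s : Finset α} (hs : ∀ x, x ∈ s ↔ ∃ y, e y = x)
    (σ : Finpartition (Finset.univ : Finset γ)) :
    NonCrossing (mapEmbedding e hs σ).parts ↔ NonCrossing σ.parts := by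
  rw [mapEmbedding_parts]
  constructor
  · intro h a b c d hab hbc hcd V hV W hW ha hc hb hd
    exact Finset.map_injective _ (h (e a) (e b) (e c) (e d) (e.lt_iff_lt.2 hab)
      (e.lt_iff_lt.2 hbc) (e.lt_iff_lt.2 hcd) _ (Finset.mem_image_of_mem _ hV) _
      (Finset.mem_image_of_mem _ hW) (Finset.mem_map_of_mem _ ha) (Finset.mem_map_of_mem _ hc)
      (Finset.mem_map_of_mem _ hb) (Finset.mem_map_of_mem _ hd))
  · intro h a b c d hab hbc hcd V hV W hW ha hc hb hd
    obtain ⟨V, hV', rfl⟩ := Finset.mem_image.1 hV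
    obtain ⟨W, hW', rfl⟩ := Finset.mem_image.1 hW
    obtain ⟨a, ha', rfl⟩ := Finset.mem_map.1 ha
    obtain ⟨b, hb', rfl⟩ := Finset.mem_map.1 hb
    obtain ⟨c, hc', rfl⟩ := Finset.mem_map.1 hc
    obtain ⟨d, hd', rfl⟩ := Finset.mem_map.1 hd
    rw [h a b c d (e.lt_iff_lt.1 hab) (e.lt_iff_lt.1 hbc) (e.lt_iff_lt.1 hcd) V hV' W hW' ha' hc'
      hb' hd']

theorem isConnectedOn_mapEmbedding {β δ : Type*} [LinearOrder β] [LinearOrder δ] [Fintype δ]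
    (e : γ ↪o α) {s : Finset α} (hs : ∀ x, x ∈ s ↔ ∃ y, e y = x) (f : α → β) (g : γ → δ)
    (v : δ ↪o β) (hfg : ∀ y, f (e y) = v (g y)) {V : Finset β} (hV : ∀ x, x ∈ V ↔ ∃ y, v y = x)
    (σ : Finpartition (Finset.univ : Finset γ)) :
    IsConnectedOn f (mapEmbedding e hs σ) V ↔ IsConnectedOn g σ Finset.univ := by
  have hsat : ∀ S : Finset δ, IsSaturated f (mapEmbedding e hs σ) (S.map v.toEmbedding) ↔
      IsSaturated g σ S := by
    intro S
    have hmem : ∀ y, f (e y) ∈ S.map v.toEmbedding ↔ g y ∈ S := fun y => by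
      rw [hfg]
      exact Finset.mem_map' v.toEmbedding
    constructor
    · intro h U hU x hx y hy hxS
      exact (hmem y).1 (h _ (Finset.mem_image_of_mem _ hU) (e x) (Finset.mem_map_of_mem _ hx)
        (e y) (Finset.mem_map_of_mem _ hy) ((hmem x).2 hxS))
    · intro h U hU x hx y hy hxS
      obtain ⟨U, hU', rfl⟩ := Finset.mem_image.1 hU
      obtain ⟨x, hx', rfl⟩ := Finset.mem_map.1 hx
      obtain ⟨y, hy', rfl⟩ := Finset.mem_map.1 hy
      exact (hmem y).2 (h U hU' x hx' y hy' ((hmem x).1 hxS))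
  have huniv : V = Finset.univ.map v.toEmbedding := by
    ext x
    rw [hV]
    simp
  constructor
  · intro h S _ hne hS
    have hSV : S.map v.toEmbedding ⊆ V := by
      rw [huniv]
      exact Finset.map_subset_map.2 (Finset.subset_univ S)
    have := h (S.map v.toEmbedding) hSV (Finset.map_nonempty.2 hne) ((hsat S).2 hS)
    rw [huniv] at this
    exact Finset.map_injective _ this
  · intro h S hSV hne hS
    obtain ⟨S, -, rfl⟩ := Finset.subset_map_iff.1 (huniv ▸ hSV)
    rw [h S (Finset.subset_univ S) (Finset.map_nonempty.1 hne) ((hsat S).1 hS), huniv]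

end Transport

/-! ### Block weights, and uniqueness in the moment-cumulant formula -/

section BlockWeight

variable {A : Type*}

/-- The factor of the block `U` in `blockProd`. -/
noncomputable def blockWeight {α : Type*} [LinearOrder α] (f : (n : ℕ) → (Fin n → A) → ℂ)
    (a : α → A) (U : Finset α) : ℂ :=
  f U.card (fun j => a (U.orderEmbOfFin rfl j))

theorem blockWeight_eq {α : Type*} [LinearOrder α] (f : (n : ℕ) → (Fin n → A) → ℂ)
    (a : α → A) (U : Finset α) {m : ℕ} (h : U.card = m) (v : Fin m ↪o α) (hv : ∀ j, v j ∈ U) :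
    blockWeight f a U = f m (fun j => a (v j)) := by
  subst h
  have := Finset.orderEmbOfFin_unique (s := U) rfl hv v.strictMono
  unfold blockWeight
  rw [this]

theorem blockWeight_map {α γ : Type*} [LinearOrder α] [LinearOrder γ]
    (f : (n : ℕ) → (Fin n → A) → ℂ) (a : α → A) (e : γ ↪o α) (U : Finset γ) :
    blockWeight f a (U.map e.toEmbedding) = blockWeight f (fun y => a (e y)) U :=
  blockWeight_eq f a _ (Finset.card_map _) ((U.orderEmbOfFin rfl).trans e)
    fun j => Finset.mem_map_of_mem _ (Finset.orderEmbOfFin_mem U rfl j)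

open Classical in
theorem sum_nc_eq {n : ℕ} (w : Finset (Fin n) → ℂ) :
    ∑ π : NC n, ∏ V ∈ π.1.parts, w V =
      ∑ π : Finpartition (Finset.univ : Finset (Fin n)) with NonCrossing π.parts,
        ∏ V ∈ π.parts, w V := by
  symm
  refine Finset.sum_subtype _ (fun π => ?_) _
  simp only [Finset.mem_filter, Finset.mem_univ, true_and]
  exact Iff.rfl

theorem isNonCrossing_indiscrete {n : ℕ} (hne : (Finset.univ : Finset (Fin n)) ≠ ∅) :
    IsNonCrossing (Finpartition.indiscrete hne) := by
  intro a b c d _ _ _ V hV W hW _ _ _ _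
  rw [Finpartition.indiscrete_parts, Finset.mem_singleton] at hV hW
  rw [hV, hW]

theorem eq_indiscrete_of_univ_mem {n : ℕ} (hne : (Finset.univ : Finset (Fin n)) ≠ ∅)
    {π : Finpartition (Finset.univ : Finset (Fin n))} (h : Finset.univ ∈ π.parts) :
    π = Finpartition.indiscrete hne := by
  refine Finpartition.ext (Finset.ext fun V => ?_)
  rw [Finpartition.indiscrete_parts, Finset.mem_singleton]
  refine ⟨fun hV => ?_, fun hV => hV ▸ h⟩
  obtain ⟨x, hx⟩ := π.nonempty_of_mem_parts hV
  exact π.eq_of_mem_parts hV h hx (Finset.mem_univ _)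

theorem sum_nc_eq_add {n : ℕ} (hn : 1 ≤ n) (w : Finset (Fin n) → ℂ) :
    ∑ π : NC n, ∏ V ∈ π.1.parts, w V =
      w Finset.univ + ∑ π : NC n with Finset.univ ∉ π.1.parts, ∏ V ∈ π.1.parts, w V := by
  have hne : (Finset.univ : Finset (Fin n)) ≠ ∅ :=
    Finset.nonempty_iff_ne_empty.1 ⟨⟨0, hn⟩, Finset.mem_univ _⟩
  rw [← Finset.sum_filter_not_add_sum_filter _ (fun π : NC n => Finset.univ ∉ π.1.parts)]
  congr 1
  rw [Finset.sum_eq_single ⟨Finpartition.indiscrete hne, isNonCrossing_indiscrete hne⟩]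
  · simp
  · intro π hπ h
    simp only [Finset.mem_filter, Finset.mem_univ, true_and, not_not] at hπ
    exact absurd (Subtype.ext (eq_indiscrete_of_univ_mem hne hπ)) h
  · intro h
    simp at h

/-- A sequence is determined by its sums over non-crossing partitions. -/
theorem eq_of_sum_nc_eq {g c : ℕ → ℂ}
    (h : ∀ n, 1 ≤ n → ∑ π : NC n, ∏ V ∈ π.1.parts, g V.card =
      ∑ π : NC n, ∏ V ∈ π.1.parts, c V.card) (n : ℕ) (hn : 1 ≤ n) : g n = c n := by
  induction n using Nat.strong_induction_on with
  | _ n ih =>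
    have := h n hn
    rw [sum_nc_eq_add hn (fun V => g V.card), sum_nc_eq_add hn (fun V => c V.card)] at this
    -- Apart from the top term, only block sizes below n occur, so induction applies and these terms
    -- cancel.
    rw [Finset.sum_congr rfl (g := fun π : NC n => ∏ V ∈ π.1.parts, c V.card) fun π hπ =>
      Finset.prod_congr rfl fun V hV => ih _ (card_lt_of_ne_univ (Finset.mem_filter.1 hπ).2 hV)
        (Finset.card_pos.2 (π.1.nonempty_of_mem_parts hV))] at this
    simpa using add_right_cancel this

end BlockWeight

/-! ### Cumulants of a product as a sum over connecting partitions -/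

section Periodic

variable {A : Type*} {n k : ℕ}

theorem divNat_monotone : Monotone (Fin.divNat : Fin (n * k) → Fin n) := by
  intro x y h
  rw [Fin.le_def] at h ⊢
  exact Nat.div_le_div_right h

/-- The points of `Fin (n * k)` that lie over `V`, in increasing order. -/
def overEmb (k : ℕ) (V : Finset (Fin n)) : Fin (V.card * k) ↪o Fin (n * k) :=
  OrderEmbedding.ofStrictMono
    (fun j => finProdFinEquiv (V.orderEmbOfFin rfl j.divNat, j.modNat)) (by
      intro x y h
      have hx : x.1 % k + k * (x.1 / k) = x.1 := Nat.mod_add_div _ _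
      have hy : y.1 % k + k * (y.1 / k) = y.1 := Nat.mod_add_div _ _
      have hk : 0 < k := Nat.pos_of_ne_zero fun h0 => by
        have := x.2
        simp [h0] at this
      -- The order is lexicographic in group and position: either the group increases, or it is
      -- equal and the residue decides.
      rcases lt_or_eq_of_le (divNat_monotone h.le) with hd | hd
      · have h1 : (V.orderEmbOfFin rfl x.divNat).1 + 1 ≤ (V.orderEmbOfFin rfl y.divNat).1 :=
          (V.orderEmbOfFin rfl).strictMono hd
        have h2 := Nat.mul_le_mul_left k h1
        have h3 := Nat.mod_lt x.1 hk
        rw [Fin.lt_def]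
        simp only [finProdFinEquiv_apply_val, Fin.coe_modNat]
        rw [Nat.mul_add] at h2
        omega
      · rw [Fin.lt_def] at h ⊢
        simp only [finProdFinEquiv_apply_val, Fin.coe_modNat, hd]
        have hd' : x.1 / k = y.1 / k := congrArg Fin.val hd
        rw [hd'] at hx
        omega)

theorem divNat_overEmb (V : Finset (Fin n)) (j : Fin (V.card * k)) :
    (overEmb k V j).divNat = V.orderEmbOfFin rfl j.divNat :=
  congrArg Prod.fst (finProdFinEquiv.symm_apply_apply (V.orderEmbOfFin rfl j.divNat, j.modNat))

theorem modNat_overEmb (V : Finset (Fin n)) (j : Fin (V.card * k)) :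
    (overEmb k V j).modNat = j.modNat :=
  congrArg Prod.snd (finProdFinEquiv.symm_apply_apply (V.orderEmbOfFin rfl j.divNat, j.modNat))

theorem mem_range_orderEmbOfFin (V : Finset (Fin n)) (x : Fin n) :
    x ∈ V ↔ ∃ y, V.orderEmbOfFin rfl y = x := by
  rw [← Set.mem_range, Finset.range_orderEmbOfFin, Finset.mem_coe]

theorem mem_range_overEmb (V : Finset (Fin n)) (x : Fin (n * k)) :
    x ∈ Finset.univ.filter (fun x : Fin (n * k) => x.divNat ∈ V) ↔
      ∃ y, overEmb k V y = x := by
  simp only [Finset.mem_filter, Finset.mem_univ, true_and]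
  constructor
  · intro h
    obtain ⟨i, hi⟩ := (mem_range_orderEmbOfFin V _).1 h
    refine ⟨finProdFinEquiv (i, x.modNat), ?_⟩
    apply finProdFinEquiv.symm.injective
    refine Prod.ext ?_ ?_
    · change (overEmb k V _).divNat = x.divNat
      rw [divNat_overEmb, ← hi]
      exact congrArg _ (congrArg Prod.fst (finProdFinEquiv.symm_apply_apply (i, x.modNat)))
    · change (overEmb k V _).modNat = x.modNat
      rw [modNat_overEmb]
      exact congrArg Prod.snd (finProdFinEquiv.symm_apply_apply (i, x.modNat))
  · rintro ⟨y, rfl⟩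
    rw [divNat_overEmb]
    exact Finset.orderEmbOfFin_mem _ _ _

open Classical in
/-- The contribution to the moments of the partitions that connect all `n` groups of `k` points. -/
noncomputable def connectedSum (f : (n : ℕ) → (Fin n → A) → ℂ) {k : ℕ} (a : Fin k → A) (n : ℕ) :
    ℂ :=
  ∑ σ : Finpartition (Finset.univ : Finset (Fin (n * k))) with
    NonCrossing σ.parts ∧ IsConnectedOn Fin.divNat σ Finset.univ,
    ∏ U ∈ σ.parts, blockWeight f (fun j => a j.modNat) U

/-- The contribution of V depends only on its size: `overEmb` renumbers the groups in V but keeps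
positions mod k, and the letters depend only on these. -/
theorem sum_nc_eq_sum_connectedSum (f : (n : ℕ) → (Fin n → A) → ℂ) (a : Fin k → A) (n : ℕ) :
    ∑ σ : NC (n * k), ∏ U ∈ σ.1.parts, blockWeight f (fun j => a j.modNat) U =
      ∑ ρ : NC n, ∏ V ∈ ρ.1.parts, connectedSum f a V.card := by
  classical
  rw [sum_nc_eq, sum_nc_eq (fun V => connectedSum f a V.card),
    sum_nonCrossing_eq_sum_components divNat_monotone]
  refine Finset.sum_congr rfl fun ρ _ => Finset.prod_congr rfl fun V _ => ?_
  symm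
  unfold connectedSum
  refine Finset.sum_bij (fun σ _ => mapEmbedding (overEmb k V) (mem_range_overEmb V) σ)
    ?_ ?_ ?_ ?_
  · intro σ hσ
    simp only [Finset.mem_filter, Finset.mem_univ, true_and] at hσ ⊢
    rw [nonCrossing_mapEmbedding, isConnectedOn_mapEmbedding _ _ _ Fin.divNat
      (V.orderEmbOfFin rfl) (divNat_overEmb V) (mem_range_orderEmbOfFin V)]
    exact hσ
  · intro σ _ σ' _ h
    exact (mapEmbedding_bijective _ (mem_range_overEmb V)).1 h
  · intro τ hτ
    obtain ⟨σ, rfl⟩ := (mapEmbedding_bijective _ (mem_range_overEmb V)).2 τ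
    refine ⟨σ, ?_, rfl⟩
    simp only [Finset.mem_filter, Finset.mem_univ, true_and] at hτ ⊢
    rwa [nonCrossing_mapEmbedding, isConnectedOn_mapEmbedding _ _ _ Fin.divNat
      (V.orderEmbOfFin rfl) (divNat_overEmb V) (mem_range_orderEmbOfFin V)] at hτ
  · intro σ _
    rw [mapEmbedding_parts, Finset.prod_image fun U _ W _ h => Finset.map_injective _ h]
    refine Finset.prod_congr rfl fun U _ => ?_
    rw [blockWeight_map]
    simp only [modNat_overEmb]

theorem prod_ofFn_pow {A : Type*} [Monoid A] (a : Fin k → A) (n : ℕ) :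
    (List.ofFn a).prod ^ n = (List.ofFn fun j : Fin (n * k) => a j.modNat).prod := by
  rw [List.ofFn_mul, List.prod_flatten, List.map_ofFn]
  have h : (List.prod ∘ fun i : Fin n => List.ofFn fun j : Fin k =>
      a (Fin.modNat (⟨i * k + j, by
        calc
          ↑i * k + j < (i + 1) * k :=
            (Nat.add_lt_add_left j.prop _).trans_eq (by rw [Nat.add_mul, Nat.one_mul])
          _ ≤ _ := Nat.mul_le_mul_right _ i.prop⟩ : Fin (n * k)))) =
      fun _ => (List.ofFn a).prod := by
    funext i
    refine congrArg (fun f => (List.ofFn f).prod) (funext fun j => congrArg a (Fin.ext ?_))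
    rw [Fin.coe_modNat]
    simp [Nat.mod_eq_of_lt j.2]
  rw [h, List.ofFn_const, List.prod_replicate]

variable [Ring A] [Algebra ℂ A]

theorem moment_pow_eq (τ : A →ₗ[ℂ] ℂ) (a : Fin k → A) (hk : 1 ≤ k) (hn : 1 ≤ n) :
    τ ((List.ofFn a).prod ^ n) = ∑ σ : NC (n * k),
      ∏ U ∈ σ.1.parts, blockWeight (freeCumulant τ) (fun j => a j.modNat) U := by
  rw [prod_ofFn_pow, moment_eq_sum_freeCumulant τ (Nat.mul_pos hn hk)]
  rfl

/-- The free cumulants of a product of variables. -/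
theorem freeCumulant_prod (τ : A →ₗ[ℂ] ℂ) (a : Fin k → A) (hk : 1 ≤ k) (hn : 1 ≤ n) :
    freeCumulant τ n (fun _ => (List.ofFn a).prod) = connectedSum (freeCumulant τ) a n := by
  refine eq_of_sum_nc_eq (g := fun n => freeCumulant τ n fun _ => (List.ofFn a).prod)
    (fun n hn => ?_) n hn
  rw [← sum_nc_eq_sum_connectedSum, ← moment_pow_eq τ a hk hn]
  have h := moment_eq_sum_freeCumulant τ hn fun _ : Fin n => (List.ofFn a).prod
  rw [List.ofFn_const, List.prod_replicate] at h
  exact h.symm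

end Periodic

/-! ### The Kreweras complement as a relation, and its injectivity -/

section Kreweras

theorem complSetoid_iff {m : ℕ} {π : Finpartition (Finset.univ : Finset (Fin m))} {i j : Fin m} :
    complSetoid π i j ↔
      ∀ V ∈ π.parts, ∀ p ∈ V, ∀ q ∈ V, ((p ≤ i ↔ p ≤ j) ↔ (q ≤ i ↔ q ≤ j)) := Iff.rfl

/-- The form used for counting: (i, j] is a union of blocks of π. -/
theorem complSetoid_iff_of_le {m : ℕ} {π : Finpartition (Finset.univ : Finset (Fin m))}
    {i j : Fin m} (hij : i ≤ j) :
    complSetoid π i j ↔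
      ∀ V ∈ π.parts, ∀ p ∈ V, ∀ q ∈ V, i < p → p ≤ j → i < q ∧ q ≤ j := by
  rw [complSetoid_iff]
  simp only [Fin.lt_def, Fin.le_def] at *
  constructor
  · intro h V hV p hp q hq _ _
    have := h V hV p hp q hq
    omega
  · intro h V hV p hp q hq
    have := h V hV p hp q hq
    have := h V hV q hq p hp
    omega

/-- The odd point p lies between the even points i and j exactly when i < p ≤ j, so a block of π
only partly inside (i, j] would cross W. -/
theorem complSetoid_of_mem {m : ℕ} {π σ : Finpartition (Finset.univ : Finset (Fin m))}
    (h : IsNonCrossing (interleave π σ)) {W : Finset (Fin m)} (hW : W ∈ σ.parts) {i j : Fin m}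
    (hi : i ∈ W) (hj : j ∈ W) : complSetoid π i j := by
  wlog hij : i ≤ j generalizing i j
  · exact (complSetoid π).symm (this hj hi (le_of_not_ge hij))
  rw [complSetoid_iff_of_le hij]
  intro U hU p hp q hq hip hpj
  have hne : U.map oddPos ≠ W.map evenPos := by
    intro h
    obtain ⟨q, _, hq⟩ := Finset.mem_map.1 (h ▸ Finset.mem_map_of_mem oddPos hp)
    exact oddPos_ne_evenPos _ _ hq.symm
  have hU' : U.map oddPos ∈ (interleave π σ).parts := mem_interleave.2 (Or.inl ⟨U, hU, rfl⟩)
  have hW' : W.map evenPos ∈ (interleave π σ).parts := mem_interleave.2 (Or.inr ⟨W, hW, rfl⟩)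
  have hp' := Finset.mem_map_of_mem oddPos hp
  have hq' := Finset.mem_map_of_mem oddPos hq
  have hi' := Finset.mem_map_of_mem evenPos hi
  have hj' := Finset.mem_map_of_mem evenPos hj
  rw [Fin.lt_def] at hip
  rw [Fin.le_def] at hpj
  rw [Fin.lt_def, Fin.le_def]
  by_contra hcon
  rcases le_or_gt q.1 i.1 with hqi | hqi
  · refine hne (h (oddPos q) (evenPos i) (oddPos p) (evenPos j) ?_ ?_ ?_ _ hU' _ hW' hq' hp' hi'
      hj') <;> simp only [Fin.lt_def, oddPos_val, evenPos_val] <;> omega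
  · refine hne (h (evenPos i) (oddPos p) (evenPos j) (oddPos q) ?_ ?_ ?_ _ hW' _ hU' hi' hj' hp'
      hq').symm <;> simp only [Fin.lt_def, oddPos_val, evenPos_val] <;> omega

open Classical in
theorem mem_iff_of_mem_ofSetoid {m : ℕ} {s : Setoid (Fin m)} {V : Finset (Fin m)}
    (hV : V ∈ (Finpartition.ofSetoid s).parts) {i : Fin m} (hi : i ∈ V) (j : Fin m) :
    j ∈ V ↔ s i j := by
  rw [← Finpartition.mem_part_ofSetoid_iff_rel, Finpartition.part_eq_of_mem _ hV hi]

open Classical in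
-- If (a, c] and (b, d] are unions of blocks of π, so is their difference (a, b].
theorem isNonCrossing_ofSetoid_complSetoid {m : ℕ}
    (π : Finpartition (Finset.univ : Finset (Fin m))) :
    IsNonCrossing (Finpartition.ofSetoid (complSetoid π)) := by
  intro a b c d hab hbc hcd V hV W hW ha hc hb hd
  have h1 := (mem_iff_of_mem_ofSetoid hV ha c).1 hc
  have h2 := (mem_iff_of_mem_ofSetoid hW hb d).1 hd
  refine Finpartition.eq_of_mem_parts _ hV hW ((mem_iff_of_mem_ofSetoid hV ha b).2 ?_) hb
  intro U hU p hp q hq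
  have h1' := h1 U hU p hp q hq
  have h2' := h2 U hU p hp q hq
  simp only [Fin.lt_def, Fin.le_def] at *
  omega

open Classical in
theorem isNonCrossing_interleave_complSetoid {m : ℕ} (π : NC m) :
    IsNonCrossing (interleave π.1 (Finpartition.ofSetoid (complSetoid π.1))) := by
  intro a b c d hab hbc hcd V hV W hW ha hc hb hd
  rcases mem_interleave.1 hV with ⟨V, hV', rfl⟩ | ⟨V, hV', rfl⟩ <;>
  rcases mem_interleave.1 hW with ⟨W, hW', rfl⟩ | ⟨W, hW', rfl⟩ <;>
  obtain ⟨a, ha', rfl⟩ := Finset.mem_map.1 ha <;>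
  obtain ⟨b, hb', rfl⟩ := Finset.mem_map.1 hb <;>
  obtain ⟨c, hc', rfl⟩ := Finset.mem_map.1 hc <;>
  obtain ⟨d, hd', rfl⟩ := Finset.mem_map.1 hd <;>
  simp only [Fin.lt_def, oddPos_val, evenPos_val] at hab hbc hcd
  · rw [π.2 a b c d (Fin.lt_def.2 (by omega)) (Fin.lt_def.2 (by omega))
      (Fin.lt_def.2 (by omega)) V hV' W hW' ha' hc' hb' hd']
  · have := (mem_iff_of_mem_ofSetoid hW' hb' d).1 hd' V hV' a ha' c hc'
    simp only [Fin.le_def] at this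
    omega
  · have := (mem_iff_of_mem_ofSetoid hV' ha' c).1 hc' W hW' b hb' d hd'
    simp only [Fin.le_def] at this
    omega
  · rw [isNonCrossing_ofSetoid_complSetoid π.1 a b c d (Fin.lt_def.2 (by omega))
      (Fin.lt_def.2 (by omega)) (Fin.lt_def.2 (by omega)) V hV' W hW' ha' hc' hb' hd']

/-- The partition into classes of `complSetoid` is admissible, hence below the greatest element;
`complSetoid_of_mem` gives the other direction. -/
theorem mem_kreweras_iff {m : ℕ} {π : NC m} {W : Finset (Fin m)}
    (hW : W ∈ (kreweras π).1.parts) {i : Fin m} (hi : i ∈ W) (j : Fin m) :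
    j ∈ W ↔ complSetoid π.1 i j := by
  classical
  refine ⟨complSetoid_of_mem (kreweras_isGreatest π).1 hW hi, fun h => ?_⟩
  have hle := (kreweras_isGreatest π).2
    (show ⟨_, isNonCrossing_ofSetoid_complSetoid π.1⟩ ∈ _ from
      isNonCrossing_interleave_complSetoid π)
  obtain ⟨V, ⟨hV, hiV⟩, -⟩ :=
    (Finpartition.ofSetoid (complSetoid π.1)).existsUnique_mem (Finset.mem_univ i)
  obtain ⟨W', hW', hVW⟩ := hle hV
  rw [(kreweras π).1.eq_of_mem_parts hW hW' hi (hVW hiV)]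
  exact hVW ((mem_iff_of_mem_ofSetoid hV hiV j).2 h)

theorem exists_mem_kreweras_iff {m : ℕ} {π : NC m} {i j : Fin m} :
    (∃ W ∈ (kreweras π).1.parts, i ∈ W ∧ j ∈ W) ↔ complSetoid π.1 i j := by
  constructor
  · rintro ⟨W, hW, hi, hj⟩
    exact (mem_kreweras_iff hW hi j).1 hj
  · intro h
    obtain ⟨W, hW, hi⟩ := (kreweras π).1.exists_mem (Finset.mem_univ i)
    exact ⟨W, hW, hi, (mem_kreweras_iff hW hi j).2 h⟩

/-- The region between two consecutive elements of a block. -/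
theorem complSetoid_of_consecutive {m : ℕ} (π : NC m) {V : Finset (Fin m)} (hV : V ∈ π.1.parts)
    {p q j : Fin m} (hp : p ∈ V) (hq : q ∈ V) (hpq : p < q)
    (hcons : ∀ x ∈ V, p < x → q ≤ x) (hj : j.1 + 1 = q.1) : complSetoid π.1 p j := by
  rw [Fin.lt_def] at hpq
  rw [complSetoid_iff_of_le (Fin.le_def.2 (by omega))]
  intro U hU x hx y hy hpx hxj
  have hne : U ≠ V := by
    rintro rfl
    have := hcons x hx hpx
    rw [Fin.le_def] at this hxj
    omega
  have h1 : ∀ z ∈ U, z ≠ p ∧ z ≠ q := fun z hz =>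
    ⟨fun h => hne (π.1.eq_of_mem_parts hU hV (h ▸ hz) hp),
      fun h => hne (π.1.eq_of_mem_parts hU hV (h ▸ hz) hq)⟩
  have hy1 := h1 y hy
  rw [Fin.le_def] at hxj
  have hxq : x < q := Fin.lt_def.2 (by omega)
  constructor
  · by_contra h
    have hyp : y < p := lt_of_le_of_ne (le_of_not_gt h) hy1.1
    exact hne (π.2 y p x q hyp hpx hxq U hU V hV hy hx hp hq)
  · by_contra h
    have hyq : q < y := lt_of_le_of_ne (by rw [Fin.le_def] at h ⊢; omega) hy1.2.symm
    exact hne (π.2 p x q y hpx hxq hyq V hV U hU hp hq hx hy).symm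

/-- The region outside of a block. -/
theorem complSetoid_of_extremal {m : ℕ} (π : NC m) {V : Finset (Fin m)} (hV : V ∈ π.1.parts)
    {p q j : Fin m} (hp : p ∈ V) (hq : q ∈ V) (hmin : ∀ x ∈ V, p ≤ x) (hmax : ∀ x ∈ V, x ≤ q)
    (hj : j.1 + 1 = p.1 ∨ p.1 = 0 ∧ j.1 + 1 = m) : complSetoid π.1 q j := by
  have hpq := hmin q hq
  -- The span [p, q] is a union of blocks, as a block leaving it would cross V. The point j is the
  -- cyclic predecessor of p, so q and j bound the complementary arc.
  have key : ∀ U ∈ π.1.parts, ∀ x ∈ U, ∀ y ∈ U, p ≤ x → x ≤ q → p ≤ y ∧ y ≤ q := by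
    intro U hU x hx y hy hpx hxq
    by_cases hne : U = V
    · subst hne
      exact ⟨hmin y hy, hmax y hy⟩
    have h1 : ∀ z ∈ U, z ≠ p ∧ z ≠ q := fun z hz =>
      ⟨fun h => hne (π.1.eq_of_mem_parts hU hV (h ▸ hz) hp),
        fun h => hne (π.1.eq_of_mem_parts hU hV (h ▸ hz) hq)⟩
    have hpx' : p < x := lt_of_le_of_ne hpx (h1 x hx).1.symm
    have hxq' : x < q := lt_of_le_of_ne hxq (h1 x hx).2
    constructor
    · by_contra h
      exact hne (π.2 y p x q (lt_of_not_ge h) hpx' hxq' U hU V hV hy hx hp hq)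
    · by_contra h
      exact hne (π.2 p x q y hpx' hxq' (lt_of_not_ge h) V hV U hU hp hq hx hy).symm
  rw [complSetoid_iff]
  intro U hU x hx y hy
  have h1 := key U hU x hx y hy
  have h2 := key U hU y hy x hx
  have hx2 := x.2
  have hy2 := y.2
  simp only [Fin.le_def] at *
  omega

/-- A non-crossing partition can be recovered from its complement. -/
theorem mem_block_iff {m : ℕ} (π : NC m) {V : Finset (Fin m)} (hV : V ∈ π.1.parts) {p : Fin m}
    (hp : p ∈ V) (q : Fin m) :
    q ∈ V ↔ ∀ i j, complSetoid π.1 i j → ((p ≤ i ↔ p ≤ j) ↔ (q ≤ i ↔ q ≤ j)) := by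
  refine ⟨fun hq i j h => h V hV p hp q hq, fun h => ?_⟩
  by_contra hq
  have hne : V.Nonempty := ⟨p, hp⟩
  have outer := fun j (hj : j.1 + 1 = (V.min' hne).1 ∨ (V.min' hne).1 = 0 ∧ j.1 + 1 = m) =>
    h _ j (complSetoid_of_extremal π hV (V.min'_mem hne) (V.max'_mem hne)
      (fun x hx => V.min'_le x hx) (fun x hx => V.le_max' x hx) hj)
  have hmin := V.min'_le p hp
  have hmax := V.le_max' p hp
  obtain ⟨j, hj⟩ : ∃ j : Fin m, j.1 + 1 = (V.min' hne).1 ∨ (V.min' hne).1 = 0 ∧ j.1 + 1 = m := by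
    have := (V.min' hne).2
    by_cases h0 : (V.min' hne).1 = 0
    · exact ⟨⟨m - 1, by omega⟩, Or.inr ⟨h0, Nat.sub_add_cancel (by omega)⟩⟩
    · exact ⟨⟨(V.min' hne).1 - 1, by omega⟩, Or.inl (Nat.sub_add_cancel (by omega))⟩
  have ho := outer j hj
  have hqlt := q.2
  have hplt := p.2
  -- A point q outside V lies in a gap between consecutive elements of V or outside its span; the
  -- ends of that region are related and separate q from p.
  by_cases hbelow : (V.filter (· < q)).Nonempty
  · by_cases habove : (V.filter (q < ·)).Nonempty
    · obtain ⟨hp1, hp2⟩ := Finset.mem_filter.1 (Finset.max'_mem _ hbelow)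
      obtain ⟨hq1, hq2⟩ := Finset.mem_filter.1 (Finset.min'_mem _ habove)
      set p' := (V.filter (· < q)).max' hbelow
      set q' := (V.filter (q < ·)).min' habove
      have hcons : ∀ x ∈ V, x ≤ p' ∨ q' ≤ x := by
        intro x hx
        rcases lt_trichotomy x q with h' | h' | h'
        · exact Or.inl (Finset.le_max' _ _ (Finset.mem_filter.2 ⟨hx, h'⟩))
        · exact absurd (h' ▸ hx) hq
        · exact Or.inr (Finset.min'_le _ _ (Finset.mem_filter.2 ⟨hx, h'⟩))
      have h3 := h p' ⟨q'.1 - 1, by omega⟩ (complSetoid_of_consecutive π hV hp1 hq1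
        (hp2.trans hq2) (fun x hx hpx => (hcons x hx).resolve_left (not_le_of_gt hpx))
        (Nat.sub_add_cancel (by rw [Fin.lt_def] at hq2; omega)))
      have h4 := hcons p hp
      simp only [Fin.le_def] at *
      omega
    · rw [Finset.not_nonempty_iff_eq_empty, Finset.filter_eq_empty_iff] at habove
      have h1 := habove (V.max'_mem hne)
      have h2 : V.max' hne ≠ q := fun h => hq (h ▸ V.max'_mem hne)
      simp only [Fin.lt_def, Fin.le_def, Ne, Fin.ext_iff] at *
      omega
  · rw [Finset.not_nonempty_iff_eq_empty, Finset.filter_eq_empty_iff] at hbelow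
    have h1 := hbelow (V.min'_mem hne)
    have h2 : V.min' hne ≠ q := fun h => hq (h ▸ V.min'_mem hne)
    simp only [Fin.lt_def, Fin.le_def, Ne, Fin.ext_iff] at *
    omega

/-- The complement determines the relation `complSetoid`, which determines the blocks by
`mem_block_iff`. -/
theorem kreweras_injective {m : ℕ} : Function.Injective (kreweras : NC m → NC m) := by
  intro π σ h
  have hrel : ∀ i j, complSetoid π.1 i j ↔ complSetoid σ.1 i j := fun i j => by
    rw [← exists_mem_kreweras_iff, ← exists_mem_kreweras_iff, h]
  have hpart : ∀ i, π.1.part i = σ.1.part i := by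
    intro i
    ext j
    rw [mem_block_iff π (Finpartition.part_mem _ |>.2 (Finset.mem_univ i))
        (Finpartition.mem_part _ (Finset.mem_univ i)),
      mem_block_iff σ (Finpartition.part_mem _ |>.2 (Finset.mem_univ i))
        (Finpartition.mem_part _ (Finset.mem_univ i))]
    simp only [hrel]
  have hsub : ∀ {π σ : NC m}, (∀ i, π.1.part i = σ.1.part i) → π.1.parts ⊆ σ.1.parts := by
    intro π σ hpart V hV
    obtain ⟨i, hi⟩ := π.1.nonempty_of_mem_parts hV
    rw [← Finpartition.part_eq_of_mem _ hV hi, hpart]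
    exact Finpartition.part_mem _ |>.2 (Finset.mem_univ i)
  exact Subtype.ext (Finpartition.ext
    (Finset.Subset.antisymm (hsub hpart) (hsub fun i => (hpart i).symm)))

theorem kreweras_bijective {m : ℕ} : Function.Bijective (kreweras : NC m → NC m) :=
  Finite.injective_iff_bijective.1 kreweras_injective

end Kreweras

/-! ### Block sizes of π against residues and connectedness of Kr(π) -/

section Divisible

theorem dvd_card_of_union {m k : ℕ} {π : Finpartition (Finset.univ : Finset (Fin m))}
    (hk : ∀ V ∈ π.parts, k ∣ V.card) {s : Finset (Fin m)}
    (hs : ∀ V ∈ π.parts, ∀ x ∈ V, x ∈ s → V ⊆ s) : k ∣ s.card := by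
  rw [← (π.restrict (Finset.subset_univ s)).sum_card_parts]
  refine Finset.dvd_sum fun U hU => ?_
  simp only [Finpartition.restrict, Finset.mem_erase, Finset.mem_image, Finset.inf_eq_inter,
    Finset.bot_eq_empty] at hU
  obtain ⟨hne, V, hV, rfl⟩ := hU
  obtain ⟨x, hx⟩ := Finset.nonempty_iff_ne_empty.2 hne
  rw [Finset.mem_inter] at hx
  rw [Finset.inter_eq_left.2 (hs V hV x hx.1 hx.2)]
  exact hk V hV

/-- The interval (i, j] is a union of blocks, so k divides its length j - i. -/
theorem mod_eq_of_dvd_card {m k : ℕ} {π : Finpartition (Finset.univ : Finset (Fin m))}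
    (hk : ∀ V ∈ π.parts, k ∣ V.card) {i j : Fin m} (h : complSetoid π i j) :
    i.1 % k = j.1 % k := by
  wlog hij : i ≤ j generalizing i j
  · exact (this ((complSetoid π).symm h) (le_of_not_ge hij)).symm
  have hd : k ∣ (Finset.Ioc i j).card := by
    refine dvd_card_of_union hk fun V hV x hx hxs y hy => ?_
    rw [Finset.mem_Ioc] at hxs ⊢
    exact (complSetoid_iff_of_le hij).1 h V hV x hx y hy hxs.1 hxs.2
  rw [Fin.card_Ioc] at hd
  exact (Nat.modEq_iff_dvd' hij).2 hd

variable {n k : ℕ} {π : NC (n * k)}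

/-- For consecutive elements p < q of a block, p is related to q - 1, so residues increase by one at
each step. -/
theorem orderEmbOfFin_modEq (hmod : ∀ i j, complSetoid π.1 i j → i.1 % k = j.1 % k)
    {V : Finset (Fin (n * k))} (hV : V ∈ π.1.parts) (h0 : 0 < V.card) (t : ℕ) (ht : t < V.card) :
    (V.orderEmbOfFin rfl ⟨t, ht⟩).1 ≡ (V.orderEmbOfFin rfl ⟨0, h0⟩).1 + t [MOD k] := by
  induction t with
  | zero => rfl
  | succ t ih =>
    have hlt : V.orderEmbOfFin rfl ⟨t, by omega⟩ < V.orderEmbOfFin rfl ⟨t + 1, ht⟩ :=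
      (V.orderEmbOfFin rfl).strictMono (Fin.lt_def.2 (Nat.lt_succ_self t))
    have hlt' := Fin.lt_def.1 hlt
    have hj : (V.orderEmbOfFin rfl ⟨t + 1, ht⟩).1 - 1 + 1 =
        (V.orderEmbOfFin rfl ⟨t + 1, ht⟩).1 := Nat.sub_add_cancel (by omega)
    have h := hmod _ ⟨(V.orderEmbOfFin rfl ⟨t + 1, ht⟩).1 - 1, by omega⟩
      (complSetoid_of_consecutive π hV (V.orderEmbOfFin_mem rfl _) (V.orderEmbOfFin_mem rfl _)
        hlt (fun x hx hpx => by
          obtain ⟨u, rfl⟩ := (mem_range_orderEmbOfFin V x).1 hx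
          rw [OrderEmbedding.lt_iff_lt, Fin.lt_def] at hpx
          rw [OrderEmbedding.le_iff_le, Fin.le_def]
          exact hpx) hj)
    have h' : (V.orderEmbOfFin rfl ⟨t + 1, ht⟩).1 - 1 + 1 ≡
        (V.orderEmbOfFin rfl ⟨t, by omega⟩).1 + 1 [MOD k] := Nat.ModEq.add_right 1 h.symm
    rw [hj] at h'
    exact h'.trans ((ih (by omega)).add_right 1)

/-- Going once around V, the residue increases by the size of V and returns to its initial value. -/
theorem dvd_card_of_mod_eq (hmod : ∀ i j, complSetoid π.1 i j → i.1 % k = j.1 % k)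
    {V : Finset (Fin (n * k))} (hV : V ∈ π.1.parts) : k ∣ V.card := by
  have h0 : 0 < V.card := Finset.card_pos.2 (π.1.nonempty_of_mem_parts hV)
  have hlast := orderEmbOfFin_modEq hmod hV h0 (V.card - 1) (by omega)
  set v := V.orderEmbOfFin rfl
  have hmin : ∀ x ∈ V, v ⟨0, h0⟩ ≤ x := by
    intro x hx
    obtain ⟨u, rfl⟩ := (mem_range_orderEmbOfFin V x).1 hx
    exact v.monotone (Fin.le_def.2 (Nat.zero_le _))
  have hmax : ∀ x ∈ V, x ≤ v ⟨V.card - 1, by omega⟩ := by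
    intro x hx
    obtain ⟨u, rfl⟩ := (mem_range_orderEmbOfFin V x).1 hx
    exact v.monotone (Fin.le_def.2 (Nat.le_sub_one_of_lt u.2))
  have hout := fun j hj => hmod _ j (complSetoid_of_extremal π hV (V.orderEmbOfFin_mem rfl _)
    (V.orderEmbOfFin_mem rfl _) hmin hmax hj)
  have hv0 := (v ⟨0, h0⟩).2
  have hlast' : (v ⟨V.card - 1, by omega⟩).1 + 1 ≡ (v ⟨0, h0⟩).1 + V.card [MOD k] := by
    have := hlast.add_right 1
    rwa [add_assoc, Nat.sub_add_cancel h0] at this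
  -- If V starts at 0, the cyclic predecessor is nk - 1, and the step across the end is harmless
  -- because k divides nk.
  have hwrap : (v ⟨V.card - 1, by omega⟩).1 + 1 ≡ (v ⟨0, h0⟩).1 [MOD k] := by
    by_cases hz : (v ⟨0, h0⟩).1 = 0
    · have h := hout ⟨n * k - 1, by omega⟩ (Or.inr ⟨hz, Nat.sub_add_cancel (by omega)⟩)
      have h' : (v ⟨V.card - 1, by omega⟩).1 + 1 ≡ n * k - 1 + 1 [MOD k] :=
        Nat.ModEq.add_right 1 h
      rw [Nat.sub_add_cancel (by omega)] at h'
      rw [hz]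
      exact h'.trans (Nat.modEq_zero_iff_dvd.2 (dvd_mul_left k n))
    · have h := hout ⟨(v ⟨0, h0⟩).1 - 1, by omega⟩ (Or.inl (Nat.sub_add_cancel (by omega)))
      have h' : (v ⟨V.card - 1, by omega⟩).1 + 1 ≡ (v ⟨0, h0⟩).1 - 1 + 1 [MOD k] :=
        Nat.ModEq.add_right 1 h
      rwa [Nat.sub_add_cancel (by omega)] at h'
  have := hlast'.symm.trans hwrap
  exact Nat.modEq_zero_iff_dvd.1 (Nat.ModEq.add_left_cancel' (v ⟨0, h0⟩).1 this)

theorem dvd_card_iff_mod_eq :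
    (∀ V ∈ π.1.parts, k ∣ V.card) ↔ ∀ i j, complSetoid π.1 i j → i.1 % k = j.1 % k :=
  ⟨fun h _ _ => mod_eq_of_dvd_card h, fun h _ => dvd_card_of_mod_eq h⟩

/-- In a block of `k` elements there are no two with the same residue. -/
theorem eq_of_mod_eq_of_card_eq (hmod : ∀ i j, complSetoid π.1 i j → i.1 % k = j.1 % k)
    {V : Finset (Fin (n * k))} (hV : V ∈ π.1.parts) (hc : V.card = k) {x y : Fin (n * k)}
    (hx : x ∈ V) (hy : y ∈ V) (hxy : x.1 % k = y.1 % k) : x = y := by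
  obtain ⟨⟨s, hs⟩, rfl⟩ := (mem_range_orderEmbOfFin V x).1 hx
  obtain ⟨⟨t, ht⟩, rfl⟩ := (mem_range_orderEmbOfFin V y).1 hy
  have h0 : 0 < V.card := by omega
  have h1 := orderEmbOfFin_modEq hmod hV h0 s hs
  have h2 := orderEmbOfFin_modEq hmod hV h0 t ht
  have h3 : s ≡ t [MOD k] := Nat.ModEq.add_left_cancel' _ (h1.symm.trans (Nat.ModEq.trans hxy h2))
  have h4 : s = t := Nat.ModEq.eq_of_lt_of_lt h3 (by omega) (by omega)
  subst h4
  rfl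

/-- A block with at least 2k elements contains two first points x < y of groups. No block of Kr(π)
leaves the groups from x up to, but excluding, y, so Kr(π) is not connecting. -/
theorem card_eq_of_isConnectedOn (hk : 1 ≤ k)
    (hmod : ∀ i j, complSetoid π.1 i j → i.1 % k = j.1 % k)
    (hconn : IsConnectedOn Fin.divNat (kreweras π).1 (Finset.univ : Finset (Fin n)))
    {V : Finset (Fin (n * k))} (hV : V ∈ π.1.parts) : V.card = k := by
  have h0 : 0 < V.card := Finset.card_pos.2 (π.1.nonempty_of_mem_parts hV)
  obtain ⟨c, hc⟩ := dvd_card_of_mod_eq hmod hV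
  by_contra hne
  have h2k : 2 * k ≤ V.card := by
    rcases c with _ | _ | c
    · omega
    · omega
    · rw [hc, mul_comm]
      exact Nat.mul_le_mul_left k (by omega)
  set v := V.orderEmbOfFin rfl with hv
  -- Residues run cyclically along V, so the elements with indices t and t + k are multiples of k;
  -- both exist as t + k < 2k.
  obtain ⟨t, ht, hdvd⟩ : ∃ t < k, k ∣ (v ⟨0, h0⟩).1 + t := by
    have hlt := Nat.mod_lt (v ⟨0, h0⟩).1 hk
    have hdm := Nat.mod_add_div (v ⟨0, h0⟩).1 k
    by_cases hz : (v ⟨0, h0⟩).1 % k = 0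
    · exact ⟨0, hk, by simpa using Nat.dvd_of_mod_eq_zero hz⟩
    · refine ⟨k - (v ⟨0, h0⟩).1 % k, by omega, (v ⟨0, h0⟩).1 / k + 1, ?_⟩
      rw [Nat.mul_add]
      omega
  have hx : k ∣ (v ⟨t, by omega⟩).1 := Nat.modEq_zero_iff_dvd.1
    ((orderEmbOfFin_modEq hmod hV h0 t (by omega)).trans (Nat.modEq_zero_iff_dvd.2 hdvd))
  have hy : k ∣ (v ⟨t + k, by omega⟩).1 := Nat.modEq_zero_iff_dvd.1
    ((orderEmbOfFin_modEq hmod hV h0 (t + k) (by omega)).trans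
      (Nat.modEq_zero_iff_dvd.2 (by rw [← add_assoc]; exact hdvd.add (dvd_refl k))))
  have hxy : v ⟨t, by omega⟩ < v ⟨t + k, by omega⟩ := v.strictMono (Fin.lt_def.2 (by simp; omega))
  have hxV : v ⟨t, by omega⟩ ∈ V := V.orderEmbOfFin_mem rfl _
  have hyV : v ⟨t + k, by omega⟩ ∈ V := V.orderEmbOfFin_mem rfl _
  generalize v ⟨t, by omega⟩ = x at *
  generalize v ⟨t + k, by omega⟩ = y at *
  have hdiv : ∀ z i : Fin (n * k), k ∣ z.1 → (z.divNat ≤ i.divNat ↔ z ≤ i) := by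
    intro z i hz
    rw [Fin.le_def, Fin.le_def, Fin.coe_divNat, Fin.coe_divNat, Nat.le_div_iff_mul_le hk,
      Nat.div_mul_cancel hz]
  have hS := hconn (Finset.Ico x.divNat y.divNat) (Finset.subset_univ _)
    ⟨x.divNat, by
      rw [Finset.mem_Ico]
      exact ⟨le_rfl, lt_of_not_ge fun h => hxy.not_ge ((hdiv y x hy).1 h)⟩⟩ (by
      intro W hW i hi j hj hiS
      have h := (mem_kreweras_iff hW hi j).1 hj V hV x hxV y hyV
      rw [Finset.mem_Ico, hdiv x _ hx, lt_iff_not_ge, hdiv y _ hy] at hiS ⊢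
      rw [Fin.lt_def] at hxy
      simp only [Fin.le_def] at *
      omega)
  have := hS ▸ Finset.mem_univ y.divNat
  exact lt_irrefl _ (Finset.mem_Ico.1 this).2

/-- If the component B of group 0 misses a group, its first gap is a union of components. By
`mem_block_iff` the first points of the two groups bounding the gap then share a block of π; but
both are 0 mod k, and a block of size k has no repeated residue. -/
theorem isConnectedOn_of_card_eq (hk : 1 ≤ k) (hn : 1 ≤ n) (hcard : ∀ V ∈ π.1.parts, V.card = k) :
    IsConnectedOn Fin.divNat (kreweras π).1 (Finset.univ : Finset (Fin n)) := by
  have hmod : ∀ i j, complSetoid π.1 i j → i.1 % k = j.1 % k :=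
    dvd_card_iff_mod_eq.1 fun V hV => (hcard V hV).symm.dvd
  obtain ⟨B, hB, h0⟩ := (components (Fin.divNat : _ → Fin n) (kreweras π).1).exists_mem
    (Finset.mem_univ (⟨0, hn⟩ : Fin n))
  by_cases huniv : B = Finset.univ
  · rw [← huniv]
    exact isConnectedOn_of_mem_components hB
  exfalso
  have hnc : NonCrossing (components (Fin.divNat : _ → Fin n) (kreweras π).1).parts :=
    nonCrossing_components divNat_monotone (kreweras π).2
  have hne : Bᶜ.Nonempty := by
    rwa [Finset.nonempty_iff_ne_empty, Ne, Finset.compl_eq_empty_iff]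
  have hj : Bᶜ.min' hne ∉ B := Finset.mem_compl.1 (Finset.min'_mem _ hne)
  have hlow : ∀ d, d < Bᶜ.min' hne → d ∈ B := fun d hd => by
    by_contra h
    exact hd.not_ge (Finset.min'_le _ _ (Finset.mem_compl.2 h))
  generalize Bᶜ.min' hne = j at hj hlow
  have hj0 : 0 < j.1 := Nat.pos_of_ne_zero fun h => hj (by
    rwa [show j = ⟨0, hn⟩ from Fin.ext h])
  -- the gap of `B` that starts at `j` is a union of components
  have hgap : ∀ c d : Fin (n * k), complSetoid π.1 c d →
      (j ≤ c.divNat ∧ ∀ e ∈ B, j ≤ e → c.divNat < e) →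
      (j ≤ d.divNat ∧ ∀ e ∈ B, j ≤ e → d.divNat < e) := by
    rintro c d hcd ⟨hjc, hc⟩
    obtain ⟨W, hW, hcW⟩ := (components (Fin.divNat : _ → Fin n) (kreweras π).1).exists_mem
      (Finset.mem_univ c.divNat)
    obtain ⟨U, hU, hcU, hdU⟩ := exists_mem_kreweras_iff.2 hcd
    have hdW := isSaturated_of_mem_components hW U hU c hcU d hdU hcW
    have hcB : c.divNat ∉ B := fun h => lt_irrefl _ (hc _ h hjc)
    have hWB : W ≠ B := fun h => hcB (h ▸ hcW)
    have hdB : d.divNat ∉ B := fun h => hWB (Finpartition.eq_of_mem_parts _ hW hB hdW h)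
    refine ⟨le_of_not_gt fun h => hdB (hlow _ h), fun e he hje => ?_⟩
    by_contra hed
    have hed : e < d.divNat := lt_of_le_of_ne (le_of_not_gt hed) fun h => hdB (h ▸ he)
    -- Since j is the first group outside B, group j - 1 belongs to B; with e it would make B cross
    -- W.
    have hlast : (⟨j.1 - 1, by omega⟩ : Fin n) < j := Fin.lt_def.2 (by simp; omega)
    exact hWB (hnc _ _ _ _ (hlast.trans_le hjc) (hc e he hje) hed B hB W hW (hlow _ hlast) he
      hcW hdW).symm
  have hgap' : ∀ c d : Fin (n * k), complSetoid π.1 c d →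
      ((j ≤ c.divNat ∧ ∀ e ∈ B, j ≤ e → c.divNat < e) ↔
      (j ≤ d.divNat ∧ ∀ e ∈ B, j ≤ e → d.divNat < e)) := fun c d h =>
    ⟨hgap c d h, hgap d c ((complSetoid π.1).symm h)⟩
  -- the first point of a group
  let first : Fin n → Fin (n * k) := fun b => ⟨b.1 * k, Nat.mul_lt_mul_of_pos_right b.2 hk⟩
  have hfirst : ∀ b i, first b ≤ i ↔ b ≤ i.divNat := by
    intro b i
    rw [Fin.le_def, Fin.le_def, Fin.coe_divNat, Nat.le_div_iff_mul_le hk]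
  have hcontra : ∀ b b' : Fin n, b ≠ b' → ¬ ∀ c d, complSetoid π.1 c d →
      ((first b ≤ c ↔ first b ≤ d) ↔ (first b' ≤ c ↔ first b' ≤ d)) := by
    intro b b' hbb h
    obtain ⟨V, hV, hbV⟩ := π.1.exists_mem (Finset.mem_univ (first b))
    have h1 := eq_of_mod_eq_of_card_eq hmod hV (hcard V hV) hbV
      ((mem_block_iff π hV hbV (first b')).2 h) (by simp [first])
    exact hbb (Fin.ext (Nat.eq_of_mul_eq_mul_right hk (congrArg Fin.val h1)))
  by_cases habove : (B.filter (j ≤ ·)).Nonempty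
  · obtain ⟨hB1, hB2⟩ := Finset.mem_filter.1 (Finset.min'_mem _ habove)
    have hmin : ∀ c : Fin n, (∀ e ∈ B, j ≤ e → c < e) ↔ c < (B.filter (j ≤ ·)).min' habove :=
      fun c => ⟨fun h => h _ hB1 hB2, fun h e he hje =>
        h.trans_le (Finset.min'_le _ _ (Finset.mem_filter.2 ⟨he, hje⟩))⟩
    simp only [hmin] at hgap'
    generalize (B.filter (j ≤ ·)).min' habove = b at *
    refine hcontra j b (fun h => hj (h ▸ hB1)) fun c d hcd => ?_
    have h := hgap' c d hcd
    simp only [hfirst]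
    simp only [Fin.le_def, Fin.lt_def] at *
    omega
  · rw [Finset.not_nonempty_iff_eq_empty, Finset.filter_eq_empty_iff] at habove
    have hmin : ∀ c : Fin n, (∀ e ∈ B, j ≤ e → c < e) ↔ True := fun c =>
      iff_true_intro fun e he hje => absurd hje (habove he)
    simp only [hmin, and_true] at hgap'
    -- The gap extends to the last group, so cyclically it ends at group 0, whose first point lies
    -- below every point.
    refine hcontra ⟨0, hn⟩ j (fun h => hj (h ▸ h0)) fun c d hcd => ?_
    have h := hgap' c d hcd
    simp only [hfirst, h, Fin.le_def, Nat.zero_le]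

end Divisible

/-! ### Freeness and the substitution σ = Kr(π) -/

section Free

variable {A : Type*} {k n : ℕ}

open Classical in
theorem connectedSum_eq (f : (n : ℕ) → (Fin n → A) → ℂ) (a : Fin k → A) :
    connectedSum f a n =
      ∑ σ : NC (n * k) with IsConnectedOn Fin.divNat σ.1 (Finset.univ : Finset (Fin n)),
        ∏ U ∈ σ.1.parts, blockWeight f (fun j => a j.modNat) U := by
  unfold connectedSum
  symm
  refine Finset.sum_bij (fun σ _ => σ.1) ?_ ?_ ?_ ?_
  · intro σ hσ
    simp only [Finset.mem_filter, Finset.mem_univ, true_and] at hσ ⊢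
    exact ⟨σ.2, hσ⟩
  · intro σ _ σ' _ h
    exact Subtype.ext h
  · intro σ hσ
    simp only [Finset.mem_filter, Finset.mem_univ, true_and] at hσ
    exact ⟨⟨σ, hσ.1⟩, by simpa using hσ.2, rfl⟩
  · intro σ _
    rfl

variable [Ring A] [Algebra ℂ A]

theorem prod_blockWeight_eq_zero {τ : A →ₗ[ℂ] ℂ} {a : Fin k → A} (ha : IsFree τ a)
    {σ : NC (n * k)}
    (hσ : ¬ ∀ U ∈ σ.1.parts, ∀ x ∈ U, ∀ y ∈ U, x.1 % k = y.1 % k) :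
    ∏ U ∈ σ.1.parts, blockWeight (freeCumulant τ) (fun j => a j.modNat) U = 0 := by
  push Not at hσ
  obtain ⟨U, hU, x, hx, y, hy, hxy⟩ := hσ
  refine Finset.prod_eq_zero hU (ha _ (fun p => (U.orderEmbOfFin rfl p).modNat) fun h => hxy ?_)
  obtain ⟨s, rfl⟩ := (mem_range_orderEmbOfFin U x).1 hx
  obtain ⟨t, rfl⟩ := (mem_range_orderEmbOfFin U y).1 hy
  exact congrArg Fin.val (h s t)

theorem kreweras_mod_eq_iff {π : NC (n * k)} :
    (∀ U ∈ (kreweras π).1.parts, ∀ x ∈ U, ∀ y ∈ U, x.1 % k = y.1 % k) ↔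
      ∀ V ∈ π.1.parts, k ∣ V.card := by
  rw [dvd_card_iff_mod_eq]
  constructor
  · intro h i j hij
    obtain ⟨W, hW, hi, hj⟩ := exists_mem_kreweras_iff.2 hij
    exact h W hW i hi j hj
  · intro h U hU x hx y hy
    exact h x y ((mem_kreweras_iff hU hx y).1 hy)

/-- Serves both formulas: p is connectedness for the cumulant and `True` for the moment. The σ not
of the form Kr(π) with π in P contribute mixed cumulants, which vanish. -/
theorem sum_kreweras_eq {τ : A →ₗ[ℂ] ℂ} {a : Fin k → A} (ha : IsFree τ a) (p : NC (n * k) → Prop)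
    [DecidablePred p] (P : Finset (NC (n * k)))
    (hP : ∀ π, π ∈ P ↔ (∀ V ∈ π.1.parts, k ∣ V.card) ∧ p (kreweras π)) :
    ∑ π ∈ P, blockProd (freeCumulant τ) (kreweras π) (fun j : Fin (n * k) => a j.modNat) =
      ∑ σ : NC (n * k) with p σ,
        ∏ U ∈ σ.1.parts, blockWeight (freeCumulant τ) (fun j => a j.modNat) U := by
  classical
  symm
  rw [← Finset.sum_subset (s₁ := P.image kreweras), Finset.sum_image kreweras_injective.injOn]
  · rfl
  · intro σ hσ
    obtain ⟨π, hπ, rfl⟩ := Finset.mem_image.1 hσ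
    simpa using ((hP π).1 hπ).2
  · intro σ hσ h
    obtain ⟨π, rfl⟩ := kreweras_bijective.2 σ
    refine prod_blockWeight_eq_zero ha fun hmod => h (Finset.mem_image_of_mem _ ?_)
    exact (hP π).2 ⟨kreweras_mod_eq_iff.1 hmod, by simpa using hσ⟩

end Free

end FreeProb

theorem theorem1 {A : Type*} [CStarAlgebra A] (τ : A →ₗ[ℂ] ℂ) (hτ : FreeProb.IsState τ)
    (k n : ℕ) (hk : 1 ≤ k) (hn : 1 ≤ n) (a : Fin k → A) (ha : FreeProb.IsFree τ a) :
    FreeProb.freeCumulant τ n (fun _ => (List.ofFn a).prod) =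
        ∑ π ∈ FreeProb.NCEqual k n,
          FreeProb.blockProd (FreeProb.freeCumulant τ) (FreeProb.kreweras π)
            (fun j : Fin (n * k) => a j.modNat) ∧
      τ ((List.ofFn a).prod ^ n) =
        ∑ π ∈ FreeProb.NCDivisible k n,
          FreeProb.blockProd (FreeProb.freeCumulant τ) (FreeProb.kreweras π)
            (fun j : Fin (n * k) => a j.modNat) := by
  classical
  constructor
  · rw [FreeProb.freeCumulant_prod τ a hk hn, FreeProb.connectedSum_eq]
    symm
    refine FreeProb.sum_kreweras_eq ha _ _ fun π => ?_
    simp only [FreeProb.NCEqual, Finset.mem_filter, Finset.mem_univ, true_and]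
    exact ⟨fun h => ⟨fun V hV => (h V hV).symm.dvd,
      FreeProb.isConnectedOn_of_card_eq hk hn h⟩, fun h V hV =>
      FreeProb.card_eq_of_isConnectedOn hk (FreeProb.dvd_card_iff_mod_eq.1 h.1) h.2 hV⟩
  · rw [FreeProb.moment_pow_eq τ a hk hn, FreeProb.sum_kreweras_eq ha (fun _ => True)]
    · simp
    · simp [FreeProb.NCDivisible]
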